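/- Let $\mathbb K=\mathbb R$ or $\mathbb C$, let $\mathfrak s$ be a finite-dimensional semisimple Lie algebra over $\mathbb K$, $\mathfrak g=\mathfrak s\oplus\mathbb K$ its trivial one-dimensional central extension, and $\pi_1$ the canonical Lie–Poisson bivector on $\mathfrak g^*=\mathfrak s^*\oplus\mathbb K^*$. For a bivector $\eta$ and a function $f$ on $\mathfrak g^*$ write $\eta(f)=[\eta,f]$ (Schouten bracket), that is, $\eta(f)$ is the contraction of $\eta$ with $df$ in the second index. Functions are analytic on all of $\mathfrak g^*$ (real-analytic, respectively holomorphic); $f$ is a Casimir function of $\pi_1$ if $\pi_1(f)=0$. A quadratic Poisson bivector $\pi_2$ on $\mathfrak g^*$ (that is, one with homogeneous quadratic coefficients) is *centrally linearizable* (CL) if there is $a\in\mathbb K^*\subset\mathfrak g^*$, $a\neq0$, with $\pi_2(a)=0$ such that the linearization of $\pi_2$ at $a$ (the Lie derivative of $\pi_2$ along the constant vector field $a$) equals $\pi_1$. A *Magri–Lenard chain* is an infinite sequence of functions $f_0,f_1,\dots$ with $\pi_1(f_0)=0$ and $\pi_1(f_{i+1})+\pi_2(f_i)=0$ for all $i\ge0$.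 The *canonical involutive family* of the pencil $\{\lambda_1\pi_1+\lambda_2\pi_2\}$ is the family of functions functionally generated by all members of all Magri–Lenard chains starting from Casimir functions of $\pi_1$, i.e. of all functions $\Phi(F_1,\dots,F_m)$ with $F_1,\dots,F_m$ members of such chains and $\Phi$ analytic in a neighbourhood of the image of $(F_1,\dots,F_m)$. **Theorem.** Let $\pi_2$ be a CL quadratic Poisson bivector on $\mathfrak g^*$ and let $a$ be a point as above. Let $x_0$ be the linear function on $\mathfrak g^*$ with $x_0(a)=1$ and $x_0|_{\mathfrak s^*}=0$, let $\partial/\partial x_0$ be the constant vector field $a$, and let $E$ be the Euler vector field of $\mathfrak s^*$, regarded as a vector field on $\mathfrak g^*$. 1. For every Casimir function $f$ of $\pi_1$ there is an infinite Magri–Lenard chain $f_0=f,f_1,f_2,\dots$. 2. There are a quadratic vector field $X$ and a homogeneous quadratic polynomial $q$ on $\mathfrak s^*$ (regarded as objects on $\mathfrak g^*$ independent of $x_0$) such that $$\pi_2=\Big[X+q\,\frac{\partial}{\partial x_0}-x_0E,\ \pi_1\Big].\qquad(*)$$ For all $X$ and $q$ satisfying $(*)$ there is an infinite Magri–Lenard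 chain of the form $x_0,q,f_2,f_3,\dots$; in particular, $q$ belongs to the canonical involutive family of the pencil $\{\lambda_1\pi_1+\lambda_2\pi_2\}$. -/

import Mathlib

open Module

/-! The commutator bracket of an associative ring; on the field `K` it is zero. -/
attribute [local instance 100] LieRing.ofAssociativeRing

namespace PoissonPencil

noncomputable section

/-! Geometry on the dual `g* = Dual K g` of a finite-dimensional vector space `g` over `K = ℝ` or
`K = ℂ`.  Elements `u : g` are the linear functions on `g*`; the cotangent space of `g*` at any
point is `g`, the tangent space is `g*`. -/

section General

variable {K : Type*} [RCLike K] {g : Type*} [AddCommGroup g] [Module K g]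

/-- `f` is analytic on all of `g*` (real-analytic for `K = ℝ`, holomorphic for `K = ℂ`), expressed
in linear coordinates on `g*`; the choice of the coordinates does not matter. -/
def IsAnalytic [FiniteDimensional K g] (f : Dual K g → K) : Prop :=
  AnalyticOnNhd K
    (fun y : Fin (finrank K (Dual K g)) → K => f ((finBasis K (Dual K g)).equivFun.symm y))
    Set.univ

/-- `f` is a homogeneous polynomial function of degree `d` on `g*`: a homogeneous polynomial
expression of degree `d` in the linear functions `u : g`. -/
def IsHomogeneousPoly (d : ℕ) (f : Dual K g → K) : Prop :=
  ∃ p : MvPolynomial g K, p.IsHomogeneous d ∧ ∀ φ, f φ = MvPolynomial.eval (fun u => φ u) p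

variable (K g) in
/-- A field of bilinear forms on the cotangent spaces of `g*`; it is a bivector (field) if all its
values are alternating, a condition included in `IsPoisson`. -/
abbrev BivectorField : Type _ := Dual K g → g →ₗ[K] g →ₗ[K] K

/-- The field `π(f) = [π, f]`, the contraction of `π` and `df` over the second index, evaluated at
the point `φ` and on the covector `u`: this is `π φ (u, df)`, the derivative of `f` at `φ` along
the tangent vector `π φ (u, ·)`. -/
def ham (π : BivectorField K g) (f : Dual K g → K) (φ : Dual K g) (u : g) : K :=
  lineDeriv K f φ (π φ u)

/-- `π` is a Poisson bivector: it is alternating, and its bracket satisfies the Jacobi identity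
(checked on linear functions, which is equivalent to `[π, π] = 0`). -/
structure IsPoisson (π : BivectorField K g) : Prop where
  alt : ∀ φ, (π φ).IsAlt
  jacobi : ∀ (φ : Dual K g) (u v w : g),
    ham π (fun ψ => π ψ u v) φ w + ham π (fun ψ => π ψ v w) φ u
      + ham π (fun ψ => π ψ w u) φ v = 0

/-- `π` has homogeneous quadratic coefficients. -/
def IsQuadraticBivector (π : BivectorField K g) : Prop :=
  ∀ u v : g, IsHomogeneousPoly 2 (fun φ => π φ u v)

/-- The vector field `X` has homogeneous quadratic coefficients. -/
def IsQuadraticVectorField (X : Dual K g → Dual K g) : Prop :=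
  ∀ u : g, IsHomogeneousPoly 2 (fun φ => X φ u)

/-- The Lie derivative `[X, π]` of an alternating `π`, evaluated on the linear functions `u`, `v`:
`X {u, v} - {X u, v} - {u, X v}`. -/
def lieDerivative (X : Dual K g → Dual K g) (π : BivectorField K g) (φ : Dual K g) (u v : g) : K :=
  lineDeriv K (fun ψ => π ψ u v) φ (X φ)
    + ham π (fun ψ => X ψ u) φ v - ham π (fun ψ => X ψ v) φ u

/-- The linearization `[T_a, π]` of a quadratic bivector at `a`, that is, its Lie derivative along
the constant vector field `a`. -/
def linearization (π : BivectorField K g) (a φ : Dual K g) (u v : g) : K :=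
  lineDeriv K (fun ψ => π ψ u v) φ a

variable [FiniteDimensional K g]

/-- Casimir functions of `π`: analytic functions `f` with `π(f) = 0`. -/
def IsCasimir (π : BivectorField K g) (f : Dual K g → K) : Prop :=
  IsAnalytic f ∧ ∀ φ u, ham π f φ u = 0

/-- An infinite Magri--Lenard chain: analytic functions `f 0, f 1, …` with `π₁(f 0) = 0` and
`π₁(f (i + 1)) + π₂(f i) = 0` for all `i`. -/
structure IsMagriLenardChain (π₁ π₂ : BivectorField K g) (f : ℕ → Dual K g → K) : Prop where
  analytic : ∀ i, IsAnalytic (f i)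
  zero : ∀ φ u, ham π₁ (f 0) φ u = 0
  succ : ∀ i φ u, ham π₁ (f (i + 1)) φ u + ham π₂ (f i) φ u = 0

/-- The canonical involutive family: the functions `h = Φ(F 1, …, F m)`, where every `F j` is a
member of some Magri--Lenard chain starting from a Casimir function of `π₁` and `Φ` is analytic
in a neighbourhood of the image of `(F 1, …, F m)`. -/
def canonicalFamily (π₁ π₂ : BivectorField K g) : Set (Dual K g → K) :=
  {h | ∃ (m : ℕ) (F : Fin m → Dual K g → K) (Φ : (Fin m → K) → K),
    (∀ j, ∃ f : ℕ → Dual K g → K,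
      IsCasimir π₁ (f 0) ∧ IsMagriLenardChain π₁ π₂ f ∧ ∃ i, F j = f i) ∧
    AnalyticOnNhd K Φ (Set.range fun φ j => F j φ) ∧
    ∀ φ, h φ = Φ fun j => F j φ}

end General

/-- The Lie--Poisson bivector on the dual of a Lie algebra: `{u, v}(φ) = φ ⁅u, v⁆`. -/
def liePoisson (K : Type*) [RCLike K] (g : Type*) [LieRing g] [LieAlgebra K g] :
    BivectorField K g := fun φ =>
  LinearMap.mk₂ K (fun u v => φ ⁅u, v⁆)
    (by intro u u' v; simp) (by intro c u v; simp) (by intro u v v'; simp) (by intro c u v; simp)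

/-! The one-dimensional trivial central extension `g = s × K` of `s`.  The bracket of the product
is the componentwise one, and the bracket of the field `K` is its commutator, that is, zero. -/

section CentralExtension

variable {K : Type*} [RCLike K] {s : Type*} [LieRing s] [LieAlgebra K s]

/-- The restriction `g* → s*`, i.e. the projection along `K*`. -/
def res (φ : Dual K (s × K)) : Dual K s := φ ∘ₗ LinearMap.inl K s K

/-- The inclusion `s* → g* = s* ⊕ K*`. -/
def ext (ξ : Dual K s) : Dual K (s × K) := ξ ∘ₗ LinearMap.fst K s K

/-- `π₂` is a quadratic Poisson bivector on `g*` that is centrally linearizable with respect to the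
point `a`: `a` is a nonzero element of `K* ⊆ g*`, `π₂` vanishes at `a`, and the linearization of
`π₂` at `a` is the Lie--Poisson bivector. -/
structure IsCentrallyLinearizableAt (π₂ : BivectorField K (s × K)) (a : Dual K (s × K)) :
    Prop where
  poisson : IsPoisson π₂
  quadratic : IsQuadraticBivector π₂
  mem : res a = 0
  ne_zero : a ≠ 0
  vanish : π₂ a = 0
  linear : ∀ φ u v, linearization π₂ a φ u v = liePoisson K (s × K) φ u v

/-- The linear coordinate `x₀` on `g*` that vanishes on `s*` and takes the value `1` at `a`. -/
def x₀ (a φ : Dual K (s × K)) : K := φ (0, 1) / a (0, 1)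

/-- The vector field `X + q ∂/∂x₀ - x₀ E` on `g*`, where `X` and `q` live on `s*` (and are treated
as objects on `g*` independent of `x₀`), `E` is the Euler vector field of `s*`, and
`∂/∂x₀` is the constant vector field `a`. -/
def tildeField (a : Dual K (s × K)) (X : Dual K s → Dual K s) (q : Dual K s → K)
    (φ : Dual K (s × K)) : Dual K (s × K) :=
  ext (X (res φ)) + q (res φ) • a - x₀ a φ • ext (res φ)

/-- The quadratic vector field `X` and the homogeneous quadratic polynomial `q` on `s*` present
`π₂` as the Lie derivative `[X + q ∂/∂x₀ - x₀ E, π₁]`. -/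
structure IsPresentation (π₂ : BivectorField K (s × K)) (a : Dual K (s × K))
    (X : Dual K s → Dual K s) (q : Dual K s → K) : Prop where
  vectorField : IsQuadraticVectorField X
  polynomial : IsHomogeneousPoly 2 q
  eq : ∀ φ u v, π₂ φ u v = lieDerivative (tildeField a X q) (liePoisson K (s × K)) φ u v

end CentralExtension

end

end PoissonPencil

/-! Let `s` act on functions on `g*` by the `π₁`-Hamiltonian fields of linear functions, and let `z
= (0, 1)` be the central element. The relation `π₁(h) + π₂(f) = 0` says two things: `⁅x, h⁆ = -{x,
f}₂` for all `x` in `s`, and `{z, f}₂ = 0`. Extending a chain past `f` is therefore a problem in the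
cohomology of `s`.

The first condition asks that `x ↦ -{x, f}₂` be a coboundary. It is a 1-cocycle because `f` itself
continues a chain and the two brackets are compatible (`IsCompatible.chain_cocycle`). Compatibility
is obtained by differentiating the Jacobi identity of `π₂` along `a`. Whitehead's first lemma needs
a finite-dimensional module. One is available because functions lying in finite-dimensional
invariant spaces form an algebra that is closed under partial derivatives and contains all quadratic
functions and all Casimir functions, polynomial or not. Chains never leave this algebra.

For the second condition, the field `{z, ·}₂` is `π₁`-Hamiltonian, and such fields have zero
divergence in linear coordinates. So `{z, f}₂` is a sum of brackets `⁅x, h⁆`. It is also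
`s`-invariant by the cocycle identity, and over a semisimple algebra an invariant that is a sum of
brackets vanishes (`IsCompatible.vectorField_central_eq_zero`).

The presentation is cohomological too. The quadratic functions `{x, z}₂` and `{x, y}₂ - x₀ ⁅x, y⁆`
do not depend on `x₀` and form a 1-cocycle and a 2-cocycle. Whitehead's two lemmas give primitives,
which are `q` and `X` up to normalization. The formula for `{z, ·}₂` then says that `π₁(q) + π₂(x₀)
= 0`, so the extension procedure can start from the pair `x₀, q`. -/

namespace LieAlgebra

open LieModule

/-! ### Semisimple Lie algebras and Whitehead's lemmas -/

section Whitehead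

variable {K : Type*} [Field K] {s : Type*} [LieRing s] [LieAlgebra K s]

section Semisimple

variable [IsSemisimple K s]

theorem IsSemisimple.lie_self_of_isAtom {I : LieIdeal K s} (hI : IsAtom I) : ⁅I, I⁆ = I := by
  rcases hI.le_iff.mp (LieSubmodule.lie_le_left I I) with h | h
  · refine absurd ?_ (IsSemisimple.non_abelian_of_isAtom I hI)
    refine ⟨fun x y => Subtype.ext ?_⟩
    have := LieSubmodule.lie_mem_lie (I := I) (N := I) x.2 y.2
    rw [h, LieSubmodule.mem_bot] at this
    simpa using this
  · exact h

theorem IsSemisimple.lie_top_top : ⁅(⊤ : LieIdeal K s), (⊤ : LieIdeal K s)⁆ = ⊤ := by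
  refine le_antisymm le_top ?_
  rw [← IsSemisimple.sSup_atoms_eq_top (R := K) (L := s)]
  refine sSup_le fun I hI => ?_
  rw [sSup_atoms_eq_top, ← IsSemisimple.lie_self_of_isAtom hI]
  exact LieSubmodule.mono_lie le_top le_top

/-- A linear map on a semisimple Lie algebra that kills all brackets is zero. -/
theorem IsSemisimple.linearMap_eq_zero {M : Type*} [AddCommGroup M] [Module K M]
    (f : s →ₗ[K] M) (h : ∀ x y : s, f ⁅x, y⁆ = 0) : f = 0 := by
  ext x
  have hx : x ∈ (⁅(⊤ : LieIdeal K s), (⊤ : LieIdeal K s)⁆ : LieIdeal K s) := by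
    rw [IsSemisimple.lie_top_top]; trivial
  rw [← LieSubmodule.mem_toSubmodule, LieSubmodule.lieIdeal_oper_eq_linear_span'] at hx
  have : Submodule.span K {m : s | ∃ x ∈ (⊤ : LieIdeal K s), ∃ n ∈ (⊤ : LieIdeal K s), ⁅x, n⁆ = m}
      ≤ f.ker := by
    rw [Submodule.span_le]
    rintro _ ⟨x, -, y, -, rfl⟩
    exact h x y
  exact this hx

end Semisimple

/-- A Lie algebra that equals its derived algebra acts trivially on every nilpotent module. -/
theorem lie_eq_zero_of_isNilpotent {M : Type*} [AddCommGroup M] [Module K M] [LieRingModule s M]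
    [LieModule K s M] (hs : ⁅(⊤ : LieIdeal K s), (⊤ : LieIdeal K s)⁆ = ⊤)
    [LieModule.IsNilpotent s M] (x : s) (m : M) : ⁅x, m⁆ = 0 := by
  -- Every `x` descends arbitrarily far in the lower central series: it is a sum of brackets `⁅y,
  -- z⁆`, each acting as `yz - zy`, and both factors already descend `k + 1` steps.
  have key : ∀ k j : ℕ, ∀ x : s, ∀ m ∈ lowerCentralSeries K s M j,
      ⁅x, m⁆ ∈ lowerCentralSeries K s M (j + k + 1) := by
    intro k
    induction k with
    | zero =>
      intro j x m hm
      rw [add_zero, lowerCentralSeries_succ]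
      exact LieSubmodule.lie_mem_lie trivial hm
    | succ k ih =>
      intro j x m hm
      have hx : x ∈ (⁅(⊤ : LieIdeal K s), (⊤ : LieIdeal K s)⁆ : LieIdeal K s) := by
        rw [hs]; trivial
      rw [← LieSubmodule.mem_toSubmodule, LieSubmodule.lieIdeal_oper_eq_linear_span'] at hx
      induction hx using Submodule.span_induction with
      | mem x hx =>
        obtain ⟨y, -, z, -, rfl⟩ := hx
        rw [lie_lie]
        refine sub_mem ?_ ?_
        · have := ih _ y _ (ih _ z _ hm)
          exact antitone_lowerCentralSeries K s M (by omega) this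
        · have := ih _ z _ (ih _ y _ hm)
          exact antitone_lowerCentralSeries K s M (by omega) this
      | zero => simp
      | add x y _ _ hx hy => rw [add_lie]; exact add_mem hx hy
      | smul c x _ hx => rw [smul_lie]; exact (lowerCentralSeries K s M _).smul_mem c hx
  obtain ⟨k, hk⟩ := (isNilpotent_iff K s M).mp inferInstance
  have := key k 0 x m (by simp)
  have h0 := antitone_lowerCentralSeries K s M (show k ≤ 0 + k + 1 by omega) this
  rwa [hk, LieSubmodule.mem_bot] at h0

/-! ### Casimir endomorphisms and homotopy formulas -/

section Casimir

variable {M : Type*} [AddCommGroup M] [Module K M] [LieRingModule s M] [LieModule K s M]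

/-- The Casimir endomorphism `∑ aᵢ bᵢ`. -/
def casimirEnd {ι : Type*} [Fintype ι] (a b : ι → s) (M : Type*) [AddCommGroup M] [Module K M]
    [LieRingModule s M] [LieModule K s M] : End K M :=
  ∑ i, toEnd K s M (a i) ∘ₗ toEnd K s M (b i)

theorem casimirEnd_apply {ι : Type*} [Fintype ι] (a b : ι → s) (m : M) :
    casimirEnd (K := K) a b M m = ∑ i, ⁅a i, ⁅b i, m⁆⁆ := by
  simp [casimirEnd]

/-- The tensor `∑ aᵢ ⊗ bᵢ` is invariant. -/
def IsInvariantPair (K : Type*) [Field K] {s : Type*} [LieRing s] [LieAlgebra K s] {ι : Type*}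
    [Fintype ι] (a b : ι → s) : Prop :=
  ∃ c : s → ι → ι → K, (∀ x i, ⁅x, a i⁆ = ∑ j, c x i j • a j) ∧
    ∀ x j, ⁅x, b j⁆ = - ∑ i, c x i j • b i

variable {ι : Type*} [Fintype ι] {a b : ι → s}

/-- The matrix of `x` on the `aᵢ` and its negative transpose on the `bᵢ` cancel. An arbitrary
bilinear `B` plays the role of the tensor product. -/
theorem IsInvariantPair.sum_eq_zero {N : Type*} [AddCommGroup N] [Module K N]
    (h : IsInvariantPair K a b) (B : s →ₗ[K] s →ₗ[K] N) (x : s) :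
    ∑ i, B ⁅x, a i⁆ (b i) + ∑ i, B (a i) ⁅x, b i⁆ = 0 := by
  obtain ⟨c, h₁, h₂⟩ := h
  simp only [h₁, h₂, map_sum, map_neg, map_smul, LinearMap.sum_apply, LinearMap.smul_apply,
    Finset.sum_neg_distrib]
  rw [Finset.sum_comm, add_neg_cancel]

/-- Leibniz rule, with the action on `aᵢ` transferred to `bᵢ` by invariance. The commutation of the
Casimir endomorphism with `s` and both homotopy formulas are instances of it. -/
theorem IsInvariantPair.sum_lie (h : IsInvariantPair K a b) (φ : s →ₗ[K] M) (x : s) :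
    ⁅x, ∑ i, ⁅a i, φ (b i)⁆⁆ = ∑ i, ⁅a i, ⁅x, φ (b i)⁆⁆ - ∑ i, ⁅a i, φ ⁅x, b i⁆⁆ := by
  have := h.sum_eq_zero ((LinearMap.lcomp K M φ).comp (toEnd K s M).toLinearMap) x
  simp only [LinearMap.comp_apply, LinearMap.lcomp_apply, LieHom.coe_toLinearMap,
    toEnd_apply_apply] at this
  rw [sub_eq_add_neg, ← eq_neg_of_add_eq_zero_left this, lie_sum, ← Finset.sum_add_distrib]
  refine Finset.sum_congr rfl fun i _ => ?_
  rw [lie_lie]; abel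

theorem IsInvariantPair.casimirEnd_lie (h : IsInvariantPair K a b) (x : s) (m : M) :
    casimirEnd (K := K) a b M ⁅x, m⁆ = ⁅x, casimirEnd (K := K) a b M m⁆ := by
  have := h.sum_lie ((toEnd K s M).toLinearMap.flip m) x
  simp only [LinearMap.flip_apply, LieHom.coe_toLinearMap, toEnd_apply_apply] at this
  rw [casimirEnd_apply, casimirEnd_apply, this, ← Finset.sum_sub_distrib]
  refine Finset.sum_congr rfl fun i _ => ?_
  rw [← lie_sub]; congr 1
  rw [lie_lie]; abel

/-- Homotopy formula for `1`-cocycles. -/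
theorem IsInvariantPair.casimirEnd_oneCocycle (h : IsInvariantPair K a b) (ω : s →ₗ[K] M)
    (hω : ∀ x y, ω ⁅x, y⁆ = ⁅x, ω y⁆ - ⁅y, ω x⁆) (x : s) :
    casimirEnd (K := K) a b M (ω x) = ⁅x, ∑ i, ⁅a i, ω (b i)⁆⁆ := by
  rw [h.sum_lie, casimirEnd_apply, ← Finset.sum_sub_distrib]
  refine Finset.sum_congr rfl fun i _ => ?_
  rw [← lie_sub, hω]; congr 1; abel

/-- Homotopy formula for `2`-cocycles. -/
theorem IsInvariantPair.casimirEnd_twoCocycle (h : IsInvariantPair K a b)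
    (ω : s →ₗ[K] s →ₗ[K] M) (halt : ∀ x y, ω x y = - ω y x)
    (hω : ∀ x y z, ⁅x, ω y z⁆ + ⁅y, ω z x⁆ + ⁅z, ω x y⁆
      - ω ⁅x, y⁆ z - ω ⁅y, z⁆ x - ω ⁅z, x⁆ y = 0) (x y : s) :
    casimirEnd (K := K) a b M (ω x y) =
      ⁅x, ∑ i, ⁅a i, ω (b i) y⁆⁆ - ⁅y, ∑ i, ⁅a i, ω (b i) x⁆⁆ - ∑ i, ⁅a i, ω (b i) ⁅x, y⁆⁆ := by
  have h1 := h.sum_lie (ω.flip y) x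
  have h2 := h.sum_lie (ω.flip x) y
  simp only [LinearMap.flip_apply] at h1 h2
  rw [h1, h2, casimirEnd_apply]
  simp only [← Finset.sum_sub_distrib, ← lie_sub]
  refine Finset.sum_congr rfl fun i _ => ?_
  congr 1
  have := hω (b i) x y
  rw [halt ⁅x, y⁆, halt y (b i), ← lie_skew (b i) x] at this
  simp only [lie_neg, map_neg, LinearMap.neg_apply] at this
  rw [← sub_eq_zero, ← this]
  abel

end Casimir


/-! ### Nonzero Casimir endomorphisms from trace forms -/

section ExistsCasimir

variable {M : Type*} [AddCommGroup M] [Module K M] [LieRingModule s M] [LieModule K s M]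

theorem IsSemisimple.exists_atom_lie_ne_zero [IsSemisimple K s]
    (h : ∃ (x : s) (m : M), ⁅x, m⁆ ≠ 0) :
    ∃ I : LieIdeal K s, IsAtom I ∧ ∃ x ∈ I, ∃ m : M, ⁅x, m⁆ ≠ 0 := by
  by_contra hcon
  push Not at hcon
  obtain ⟨x, m, hxm⟩ := h
  have : (⊤ : LieIdeal K s) ≤ LieModule.ker K s M := by
    rw [← IsSemisimple.sSup_atoms_eq_top (R := K) (L := s)]
    exact sSup_le fun I hI x hx => (LieModule.mem_ker K s M x).mpr (hcon I hI x hx)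
  exact hxm ((LieModule.mem_ker K s M x).mp (this (LieSubmodule.mem_top x)) m)

variable [CharZero K] [FiniteDimensional K M]

/-- The trace form is nondegenerate on every minimal ideal that acts nontrivially. -/
theorem IsSemisimple.traceForm_eq_zero [IsSemisimple K s] {I : LieIdeal K s} (hI : IsAtom I)
    (h : ∃ x ∈ I, ∃ m : M, ⁅x, m⁆ ≠ 0) (x : s) (hx : x ∈ I)
    (hxI : ∀ y ∈ I, traceForm K s M x y = 0) : x = 0 := by
  -- The radical of the trace form on `I` is an ideal of `s`, so by minimality it is `⊥` or `I`. In
  -- the second case the trace form vanishes on `I`, so the derived algebra of `I`, which is all of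
  -- `I`, acts nilpotently; being perfect, `I` then acts trivially.
  let R : LieIdeal K s :=
    { carrier := {x | x ∈ I ∧ ∀ y ∈ I, traceForm K s M x y = 0}
      add_mem' := fun {u v} hu hv => ⟨add_mem hu.1 hv.1, fun y hy => by
        rw [map_add, LinearMap.add_apply, hu.2 y hy, hv.2 y hy, add_zero]⟩
      zero_mem' := ⟨zero_mem _, fun y _ => by simp⟩
      smul_mem' := fun c u hu => ⟨I.smul_mem c hu.1, fun y hy => by
        rw [map_smul, LinearMap.smul_apply, hu.2 y hy, smul_zero]⟩
      lie_mem := fun {z u} hu => ⟨I.lie_mem hu.1, fun y hy => by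
        rw [traceForm_apply_lie_apply', hu.2 _ (I.lie_mem hy), neg_zero]⟩ }
  have hRI : R ≤ I := fun u hu => hu.1
  have hxR : x ∈ R := ⟨hx, hxI⟩
  rcases hI.le_iff.mp hRI with hR | hR
  · rw [hR] at hxR
    exact (LieSubmodule.mem_bot x).mp hxR
  · exfalso
    have h0 : traceForm K I M = 0 := by
      ext ⟨u, hu⟩ ⟨v, hv⟩
      rw [← hR] at hu
      exact hu.2 v hv
    have : IsSimple K I := IsSemisimple.isSimple_of_isAtom I hI
    have htop : ⁅(⊤ : LieIdeal K I), (⊤ : LieIdeal K I)⁆ = ⊤ := IsSemisimple.lie_top_top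
    have hnil : LieModule.IsNilpotent (derivedSeries K I 1) M :=
      isNilpotent_derivedSeries_of_traceForm_eq_zero h0
    have hnil' : LieModule.IsNilpotent I M := by
      rw [isNilpotent_iff_forall' (R := K)] at hnil ⊢
      intro u
      exact hnil ⟨u, by
        change u ∈ (⁅(⊤ : LieIdeal K I), (⊤ : LieIdeal K I)⁆ : LieIdeal K I)
        rw [htop]; trivial⟩
    obtain ⟨u, hu, m, hm⟩ := h
    exact hm (lie_eq_zero_of_isNilpotent htop (⟨u, hu⟩ : I) m)

/-- A nontrivial module over a semisimple Lie algebra has a nonzero Casimir endomorphism. -/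
theorem IsSemisimple.exists_casimirEnd_ne_zero [FiniteDimensional K s] [IsSemisimple K s]
    (h : ∃ (x : s) (m : M), ⁅x, m⁆ ≠ 0) :
    ∃ (n : ℕ) (a b : Fin n → s), IsInvariantPair K a b ∧ casimirEnd (K := K) a b M ≠ 0 := by
  obtain ⟨I, hI, hact⟩ := IsSemisimple.exists_atom_lie_ne_zero (K := K) h
  let B : LinearMap.BilinForm K I := traceForm K I M
  have hBs : ∀ x y : I, B x y = traceForm K s M x y := fun x y => rfl
  have hB : B.Nondegenerate := by
    have hl : ∀ x : I, (∀ y, B x y = 0) → x = 0 := fun x hx =>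
      Subtype.ext (IsSemisimple.traceForm_eq_zero hI hact x x.2 fun y hy => hx ⟨y, hy⟩)
    refine ⟨hl, fun y hy => hl y fun x => ?_⟩
    rw [show B y x = B x y from traceForm_comm K I M y x, hy]
  let e := finBasis K I
  let d := B.dualBasis hB e
  have hinv : ∀ (x : s) (u v : I), B ⁅x, u⁆ v = - B u ⁅x, v⁆ := fun x u v => by
    rw [hBs, hBs]
    exact traceForm_apply_lie_apply' K s M x u v
  have hde : ∀ i j, B (d i) (e j) = if j = i then 1 else 0 :=
    LinearMap.BilinForm.apply_dualBasis_left hB e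
  have hd : ∀ u : I, u = ∑ j, B u (e j) • d j := fun u => by
    conv_lhs => rw [← d.sum_repr u]
    exact Finset.sum_congr rfl fun j _ => by rw [LinearMap.BilinForm.dualBasis_repr_apply]
  have he : ∀ u : I, u = ∑ i, B (d i) u • e i := fun u => by
    conv_lhs => rw [← e.sum_repr u]
    refine Finset.sum_congr rfl fun i _ => ?_
    congr 1
    have : B (d i) u = B (d i) (∑ j, e.repr u j • e j) := by rw [e.sum_repr]
    rw [this, map_sum]
    simp only [map_smul, hde]
    simp
  refine ⟨_, fun i => (d i : s), fun i => (e i : s),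
    ⟨fun x i j => B ⁅x, d i⁆ (e j), fun x i => ?_, fun x j => ?_⟩, fun hC => ?_⟩
  · have := congrArg (Subtype.val) (hd ⁅x, d i⁆)
    simpa using this
  · have := congrArg (Subtype.val) (he ⁅x, e j⁆)
    simp only [hinv]
    simpa using this
  -- Each summand has trace `B (d i) (e i) = 1`, so the trace is the dimension of `I`, nonzero in
  -- characteristic zero.
  · have htr : LinearMap.trace K M (casimirEnd (K := K) (fun i => (d i : s)) (fun i => (e i : s)) M)
        = finrank K I := by
      rw [casimirEnd, map_sum]
      have : ∀ i, LinearMap.trace K M (toEnd K s M (d i) ∘ₗ toEnd K s M (e i)) = 1 := fun i => by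
        have := hde i i
        rwa [if_pos rfl] at this
      simp [this]
    rw [hC, map_zero] at htr
    have h0 : finrank K I = 0 := by exact_mod_cast htr.symm
    have : (I : Submodule K s) = ⊥ := Submodule.finrank_eq_zero.mp h0
    exact hI.1 (by simpa using this)

end ExistsCasimir

/-! ### Whitehead's lemmas by induction on the dimension of the module -/

section Lemmas

universe v

variable [CharZero K] [FiniteDimensional K s] [IsSemisimple K s]

/-- Induction for finite-dimensional modules over a semisimple Lie algebra: a property holds for all
of them if it holds for trivial modules, for modules with an invertible Casimir endomorphism, and
for `M` as soon as it holds for kernel and range of some Casimir endomorphism of `M`. -/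
theorem IsSemisimple.module_induction
    {P : ∀ (M : Type v) [AddCommGroup M] [Module K M] [LieRingModule s M] [LieModule K s M], Prop}
    (htriv : ∀ (M : Type v) [AddCommGroup M] [Module K M] [LieRingModule s M] [LieModule K s M]
      [FiniteDimensional K M],
      (∀ (x : s) (m : M), ⁅x, m⁆ = 0) → P M)
    (hbij : ∀ (M : Type v) [AddCommGroup M] [Module K M] [LieRingModule s M] [LieModule K s M],
      ∀ (n : ℕ) (a b : Fin n → s), IsInvariantPair K a b →
        Function.Bijective (casimirEnd (K := K) a b M) → P M)
    (hext : ∀ (M : Type v) [AddCommGroup M] [Module K M] [LieRingModule s M] [LieModule K s M],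
      ∀ f : M →ₗ⁅K, s⁆ M, P f.ker → P f.range → P M)
    (M : Type v) [AddCommGroup M] [Module K M] [LieRingModule s M] [LieModule K s M]
    [FiniteDimensional K M] : P M := by
  induction h : finrank K M using Nat.strong_induction_on generalizing M with
  | _ n ih =>
    subst h
    by_cases ht : ∀ (x : s) (m : M), ⁅x, m⁆ = 0
    · exact htriv M ht
    · push Not at ht
      obtain ⟨n, a, b, hab, hC⟩ := IsSemisimple.exists_casimirEnd_ne_zero (K := K) ht
      by_cases hinj : Function.Injective (casimirEnd (K := K) a b M)
      · exact hbij M n a b hab ⟨hinj, LinearMap.injective_iff_surjective.mp hinj⟩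
      · let f : M →ₗ⁅K, s⁆ M :=
          { casimirEnd (K := K) a b M with map_lie' := fun {x m} => hab.casimirEnd_lie x m }
        -- The endomorphism is neither injective nor zero, so kernel and range both have smaller
        -- dimension than `M`.
        have hsum := (casimirEnd (K := K) a b M).finrank_range_add_finrank_ker
        have h1 : 0 < finrank K (casimirEnd (K := K) a b M).ker :=
          finrank_pos_iff.mpr (Submodule.nontrivial_iff_ne_bot.mpr
            fun h => hinj (LinearMap.ker_eq_bot.mp h))
        have h2 : 0 < finrank K (casimirEnd (K := K) a b M).range :=
          finrank_pos_iff.mpr (Submodule.nontrivial_iff_ne_bot.mpr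
            fun h => hC (LinearMap.range_eq_bot.mp h))
        have hk : finrank K f.ker = finrank K (casimirEnd (K := K) a b M).ker := rfl
        have hr : finrank K f.range = finrank K (casimirEnd (K := K) a b M).range := by
          have : f.range.toSubmodule = (casimirEnd (K := K) a b M).range := by
            rw [LieModuleHom.toSubmodule_range]
          rw [← this]; rfl
        exact hext M f (ih _ (by omega) f.ker rfl) (ih _ (by omega) f.range rfl)

/-- **Whitehead's first lemma** -/
theorem IsSemisimple.exists_lie_eq_of_oneCocycle
    (M : Type v) [AddCommGroup M] [Module K M] [LieRingModule s M] [LieModule K s M]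
    [FiniteDimensional K M] :
    ∀ ω : s →ₗ[K] M, (∀ x y, ω ⁅x, y⁆ = ⁅x, ω y⁆ - ⁅y, ω x⁆) → ∃ m, ∀ x, ω x = ⁅x, m⁆ := by
  refine IsSemisimple.module_induction (K := K) (s := s) (P := fun M _ _ _ _ =>
    ∀ ω : s →ₗ[K] M, (∀ x y, ω ⁅x, y⁆ = ⁅x, ω y⁆ - ⁅y, ω x⁆) → ∃ m, ∀ x, ω x = ⁅x, m⁆) ?_ ?_ ?_ M
  · intro M _ _ _ _ _ ht ω hω
    have : ω = 0 := IsSemisimple.linearMap_eq_zero ω fun x y => by rw [hω, ht, ht, sub_zero]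
    exact ⟨0, fun x => by simp [this]⟩
  · intro M _ _ _ _ n a b hab hC ω hω
    obtain ⟨m, hm⟩ := hC.2 (∑ i, ⁅a i, ω (b i)⁆)
    refine ⟨m, fun x => hC.1 ?_⟩
    rw [hab.casimirEnd_oneCocycle ω hω, hab.casimirEnd_lie, hm]
  · intro M _ _ _ _ f hker hrange ω hω
    let ωr : s →ₗ[K] f.range :=
      ((f : M →ₗ[K] M) ∘ₗ ω).codRestrict f.range.toSubmodule
        fun x => (f.mem_range _).mpr ⟨ω x, rfl⟩
    have hωr : ∀ x, (ωr x : M) = f (ω x) := fun x => rfl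
    obtain ⟨⟨_, m, rfl⟩, hr⟩ := hrange ωr fun x y => Subtype.ext <| by
      push_cast
      rw [hωr, hωr, hωr, hω, map_sub, f.map_lie, f.map_lie]
    have hr' : ∀ x, f (ω x) = ⁅x, f m⁆ := fun x => congrArg Subtype.val (hr x)
    let ωk : s →ₗ[K] f.ker :=
      (ω - (toEnd K s M).toLinearMap.flip m).codRestrict f.ker.toSubmodule fun x => by
        change f (ω x - ⁅x, m⁆) = 0
        rw [map_sub, hr', f.map_lie, sub_self]
    have hωk : ∀ x, (ωk x : M) = ω x - ⁅x, m⁆ := fun x => rfl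
    obtain ⟨⟨k, _⟩, hk⟩ := hker ωk fun x y => Subtype.ext <| by
      push_cast
      rw [hωk, hωk, hωk, hω, lie_sub, lie_sub, lie_lie]
      abel
    have hk' : ∀ x, ω x - ⁅x, m⁆ = ⁅x, k⁆ := fun x => congrArg Subtype.val (hk x)
    exact ⟨m + k, fun x => by rw [lie_add, ← hk' x]; abel⟩

/-- **Whitehead's second lemma** -/
theorem IsSemisimple.exists_eq_of_twoCocycle
    (M : Type v) [AddCommGroup M] [Module K M] [LieRingModule s M] [LieModule K s M]
    [FiniteDimensional K M] :
    ∀ ω : s →ₗ[K] s →ₗ[K] M, (∀ x y, ω x y = - ω y x) →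
      (∀ x y z, ⁅x, ω y z⁆ + ⁅y, ω z x⁆ + ⁅z, ω x y⁆
        - ω ⁅x, y⁆ z - ω ⁅y, z⁆ x - ω ⁅z, x⁆ y = 0) →
      ∃ θ : s →ₗ[K] M, ∀ x y, ω x y = ⁅x, θ y⁆ - ⁅y, θ x⁆ - θ ⁅x, y⁆ := by
  refine IsSemisimple.module_induction (K := K) (s := s) (P := fun M _ _ _ _ =>
    ∀ ω : s →ₗ[K] s →ₗ[K] M, (∀ x y, ω x y = - ω y x) →
      (∀ x y z, ⁅x, ω y z⁆ + ⁅y, ω z x⁆ + ⁅z, ω x y⁆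
        - ω ⁅x, y⁆ z - ω ⁅y, z⁆ x - ω ⁅z, x⁆ y = 0) →
      ∃ θ : s →ₗ[K] M, ∀ x y, ω x y = ⁅x, θ y⁆ - ⁅y, θ x⁆ - θ ⁅x, y⁆) ?_ ?_ ?_ M
  · intro M _ _ _ _ _ ht ω halt hω
    -- For trivial `M`, a 2-cocycle is a 1-cocycle with values in `s →ₗ[K] M`, and the first lemma
    -- applies to it.
    obtain ⟨m, hm⟩ := IsSemisimple.exists_lie_eq_of_oneCocycle (K := K) (s := s) (s →ₗ[K] M) ω
      fun x y => by
        ext z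
        have := hω x y z
        simp only [ht, LinearMap.sub_apply, LieHom.lie_apply] at this ⊢
        rw [halt y ⁅x, z⁆, halt x ⁅y, z⁆, ← lie_skew x z, ← sub_eq_zero, ← neg_eq_zero, ← this]
        simp only [map_neg, LinearMap.neg_apply]
        abel
    refine ⟨m, fun x y => ?_⟩
    simp only [hm, LieHom.lie_apply, ht, sub_zero]
  · intro M _ _ _ _ n a b hab hC ω halt hω
    let θ : s →ₗ[K] M := (LinearEquiv.ofBijective _ hC).symm.toLinearMap ∘ₗ
      ∑ i, toEnd K s M (a i) ∘ₗ ω (b i)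
    have hθ : ∀ y, casimirEnd (K := K) a b M (θ y) = ∑ i, ⁅a i, ω (b i) y⁆ := fun y => by
      simp [θ]
    refine ⟨θ, fun x y => hC.1 ?_⟩
    rw [hab.casimirEnd_twoCocycle ω halt hω, map_sub, map_sub, hab.casimirEnd_lie,
      hab.casimirEnd_lie, hθ, hθ, hθ]
  · intro M _ _ _ _ f hker hrange ω halt hω
    let fr : M →ₗ[K] f.range :=
      (f : M →ₗ[K] M).codRestrict f.range (fun m => (f.mem_range _).mpr ⟨m, rfl⟩)
    have hfr : Function.Surjective fr := by
      rintro ⟨_, m, rfl⟩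
      exact ⟨m, rfl⟩
    -- This section is only linear, not equivariant. It lifts the primitive `ρ` to `σ`; subtracting
    -- the coboundary of `σ` moves `ω` into the kernel.
    obtain ⟨g, hg⟩ := fr.exists_rightInverse_of_surjective (LinearMap.range_eq_top.mpr hfr)
    have hflie : ∀ (x : s) (m : M), fr ⁅x, m⁆ = ⁅x, fr m⁆ := fun x m => Subtype.ext (f.map_lie x m)
    obtain ⟨ρ, hρ⟩ := hrange (ω.compr₂ fr) (fun x y => by simp [halt x y]) fun x y z => by
      simp only [LinearMap.compr₂_apply, ← hflie, ← map_add, ← map_sub, hω, map_zero]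
    let σ : s →ₗ[K] M := g ∘ₗ ρ
    have hσ : ∀ x, fr (σ x) = ρ x := fun x => LinearMap.congr_fun hg (ρ x)
    let dσ : s →ₗ[K] s →ₗ[K] M := (toEnd K s M).toLinearMap.compl₂ σ
      - ((toEnd K s M).toLinearMap.compl₂ σ).flip - (toEnd K s s).toLinearMap.compr₂ σ
    have hdσ : ∀ x y, dσ x y = ⁅x, σ y⁆ - ⁅y, σ x⁆ - σ ⁅x, y⁆ := fun x y => by
      simp [dσ]
    have hk0 : ∀ x y, (ω - dσ) x y ∈ f.ker := fun x y => by
      have h1 : fr ((ω - dσ) x y) = 0 := by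
        have := hρ x y
        rw [LinearMap.compr₂_apply] at this
        rw [LinearMap.sub_apply, LinearMap.sub_apply, hdσ, map_sub, this, map_sub, map_sub,
          hflie, hflie, hσ, hσ, hσ, sub_self]
      exact f.mem_ker.mpr (congrArg Subtype.val h1)
    let τ : s →ₗ[K] s →ₗ[K] f.ker := LinearMap.mk₂ K (fun x y => ⟨(ω - dσ) x y, hk0 x y⟩)
      (fun x x' y => Subtype.ext (by simp only [map_add, LinearMap.add_apply]; rfl))
      (fun c x y => Subtype.ext (by simp only [map_smul, LinearMap.smul_apply]; rfl))
      (fun x y y' => Subtype.ext (by simp only [map_add]; rfl))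
      (fun c x y => Subtype.ext (by simp only [map_smul]; rfl))
    have hτ : ∀ x y, (τ x y : M) = ω x y - (⁅x, σ y⁆ - ⁅y, σ x⁆ - σ ⁅x, y⁆) := fun x y => by
      rw [← hdσ]; rfl
    obtain ⟨θ, hθ⟩ := hker τ (fun x y => Subtype.ext <| by
        rw [hτ]
        push_cast
        rw [hτ, halt x y, ← lie_skew x y, map_neg]
        abel) fun x y z => Subtype.ext <| by
      have h1 : σ ⁅⁅x, y⁆, z⁆ + σ ⁅⁅y, z⁆, x⁆ + σ ⁅⁅z, x⁆, y⁆ = 0 := by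
        rw [← map_add, ← map_add, ← lie_skew ⁅x, y⁆ z, ← lie_skew ⁅y, z⁆ x, ← lie_skew ⁅z, x⁆ y,
          ← map_zero σ, ← neg_zero, ← lie_jacobi x y z]
        congr 1
        abel
      have h2 := hω x y z
      have e : ∀ u v : s, ∀ m : M, ⁅⁅u, v⁆, m⁆ = ⁅u, ⁅v, m⁆⁆ - ⁅v, ⁅u, m⁆⁆ := lie_lie
      push_cast
      simp only [hτ, lie_sub, e]
      refine Eq.trans ?_ ((congrArg₂ (· - ·) h2 h1).trans (sub_zero 0))
      abel
    refine ⟨σ + f.ker.incl.toLinearMap ∘ₗ θ, fun x y => ?_⟩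
    have := congrArg Subtype.val (hθ x y)
    rw [hτ] at this
    push_cast at this
    simp only [LinearMap.add_apply, LinearMap.comp_apply, LieModuleHom.coe_toLinearMap, lie_add,
      LieSubmodule.incl_apply]
    rw [← sub_eq_zero] at this ⊢
    rw [← this]
    abel

end Lemmas
end Whitehead
end LieAlgebra

namespace PoissonPencil

noncomputable section

/-! ### Analytic functions on `g*` and vector fields as derivations -/

section AnalyticFunctions

variable {K : Type*} [RCLike K] {g : Type*} [AddCommGroup g] [Module K g] [FiniteDimensional K g]

variable (K g) in
/-- A function on `g*` in linear coordinates. -/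
def inCoordinates (f : Dual K g → K) (y : Fin (finrank K (Dual K g)) → K) : K :=
  f ((finBasis K (Dual K g)).equivFun.symm y)

theorem inCoordinates_apply (f : Dual K g → K) (φ : Dual K g) :
    inCoordinates K g f ((finBasis K (Dual K g)).equivFun φ) = f φ := by
  simp [inCoordinates]

theorem IsAnalytic.hasLineDerivAt {f : Dual K g → K} (hf : IsAnalytic f) (φ v : Dual K g) :
    HasLineDerivAt K f (fderiv K (inCoordinates K g f) ((finBasis K (Dual K g)).equivFun φ)
      ((finBasis K (Dual K g)).equivFun v)) φ v := by
  have h := (hf ((finBasis K (Dual K g)).equivFun φ)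
    trivial).differentiableAt.hasFDerivAt.hasLineDerivAt ((finBasis K (Dual K g)).equivFun v)
  have : (fun t : K => f (φ + t • v)) = fun t : K => inCoordinates K g f
      ((finBasis K (Dual K g)).equivFun φ + t • (finBasis K (Dual K g)).equivFun v) := by
    funext t
    rw [← map_smul, ← map_add, inCoordinates_apply]
  unfold HasLineDerivAt at h ⊢
  rw [this]
  exact h

theorem IsAnalytic.lineDeriv_eq {f : Dual K g → K} (hf : IsAnalytic f) (φ v : Dual K g) :
    lineDeriv K f φ v = fderiv K (inCoordinates K g f) ((finBasis K (Dual K g)).equivFun φ)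
      ((finBasis K (Dual K g)).equivFun v) :=
  (hf.hasLineDerivAt φ v).lineDeriv

theorem isAnalytic_const (c : K) : IsAnalytic (fun _ : Dual K g => c) :=
  analyticOnNhd_const

theorem isAnalytic_eval (u : g) : IsAnalytic (fun φ : Dual K g => φ u) := by
  let L : (Fin (finrank K (Dual K g)) → K) →ₗ[K] K :=
    (Dual.eval K g u) ∘ₗ (finBasis K (Dual K g)).equivFun.symm.toLinearMap
  exact L.toContinuousLinearMap.analyticOnNhd _

theorem IsAnalytic.lineDeriv {f : Dual K g → K} (hf : IsAnalytic f) (v : Dual K g) :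
    IsAnalytic (fun φ => lineDeriv K f φ v) := by
  have h1 : AnalyticOnNhd K (fun y => fderiv K (inCoordinates K g f) y
      ((finBasis K (Dual K g)).equivFun v)) Set.univ :=
    (ContinuousLinearMap.apply K K ((finBasis K (Dual K g)).equivFun v)).comp_analyticOnNhd
      (AnalyticOnNhd.fderiv hf)
  refine h1.congr isOpen_univ fun y _ => ?_
  simp only [hf.lineDeriv_eq, LinearEquiv.apply_symm_apply]

theorem IsAnalytic.lineDeriv_comm {f : Dual K g → K} (hf : IsAnalytic f) (φ v w : Dual K g) :
    _root_.lineDeriv K (fun ψ => _root_.lineDeriv K f ψ v) φ w =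
      _root_.lineDeriv K (fun ψ => _root_.lineDeriv K f ψ w) φ v := by
  have key : ∀ v w : Dual K g, _root_.lineDeriv K (fun ψ => _root_.lineDeriv K f ψ v) φ w =
      fderiv K (fderiv K (inCoordinates K g f)) ((finBasis K (Dual K g)).equivFun φ)
        ((finBasis K (Dual K g)).equivFun w) ((finBasis K (Dual K g)).equivFun v) := by
    intro v w
    rw [(hf.lineDeriv v).lineDeriv_eq]
    have : inCoordinates K g (fun ψ => _root_.lineDeriv K f ψ v) = fun y =>
        fderiv K (inCoordinates K g f) y ((finBasis K (Dual K g)).equivFun v) := by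
      funext y
      simp only [inCoordinates, hf.lineDeriv_eq, LinearEquiv.apply_symm_apply]
    have hd : DifferentiableAt K (fderiv K (inCoordinates K g f))
        ((finBasis K (Dual K g)).equivFun φ) :=
      (AnalyticOnNhd.fderiv hf _ trivial).differentiableAt
    rw [this, fderiv_clm_apply hd (differentiableAt_const _)]
    simp
  rw [key, key]
  have hs : IsSymmSndFDerivAt K (inCoordinates K g f) ((finBasis K (Dual K g)).equivFun φ) :=
    (hf _ trivial).contDiffAt.isSymmSndFDerivAt (n := ⊤) (by simp)
  exact hs _ _

variable (K g) in
/-- The algebra of analytic functions on `g*`. -/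
def analyticAlgebra : Subalgebra K (Dual K g → K) where
  carrier := {f | IsAnalytic f}
  mul_mem' := fun hf hg => AnalyticOnNhd.mul hf hg
  add_mem' := fun hf hg => AnalyticOnNhd.add hf hg
  algebraMap_mem' := fun c => isAnalytic_const c

variable (K g) in
/-- The analytic functions on `g*`, as a type. -/
def AnalyticFun : Type _ := ↥(analyticAlgebra K g)

instance : CommRing (AnalyticFun K g) := inferInstanceAs (CommRing ↥(analyticAlgebra K g))

instance : Algebra K (AnalyticFun K g) := inferInstanceAs (Algebra K ↥(analyticAlgebra K g))

namespace AnalyticFun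

@[ext] theorem ext {f h : AnalyticFun K g} (H : ∀ φ, f.1 φ = h.1 φ) : f = h :=
  Subtype.ext (funext H)

variable (f h : AnalyticFun K g) (φ : Dual K g)

@[simp] theorem zero_val : (0 : AnalyticFun K g).1 φ = 0 := rfl
@[simp] theorem add_val : (f + h).1 φ = f.1 φ + h.1 φ := rfl
@[simp] theorem neg_val : (-f).1 φ = - f.1 φ := rfl
@[simp] theorem sub_val : (f - h).1 φ = f.1 φ - h.1 φ := rfl
@[simp] theorem mul_val : (f * h).1 φ = f.1 φ * h.1 φ := rfl
@[simp] theorem smul_val (c : K) : (c • f).1 φ = c * f.1 φ := rfl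
@[simp] theorem algebraMap_val (c : K) : (algebraMap K (AnalyticFun K g) c).1 φ = c := rfl

/-- Evaluation at a point. -/
def evalHom (φ : Dual K g) : AnalyticFun K g →ₐ[K] K :=
  (Pi.evalAlgHom K (fun _ => K) φ).comp (analyticAlgebra K g).val

theorem evalHom_apply : evalHom φ f = f.1 φ := rfl

@[simp] theorem sum_val {ι : Type*} (t : Finset ι) (F : ι → AnalyticFun K g) :
    (∑ i ∈ t, F i).1 φ = ∑ i ∈ t, (F i).1 φ :=
  map_sum (evalHom φ) F t

end AnalyticFun

variable (K) in
/-- The linear function on `g*` given by an element of `g`. -/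
def coord : g →ₗ[K] AnalyticFun K g where
  toFun u := ⟨fun φ => φ u, isAnalytic_eval u⟩
  map_add' u v := AnalyticFun.ext fun φ => map_add φ u v
  map_smul' c u := AnalyticFun.ext fun φ => map_smul φ c u

@[simp] theorem coord_val (u : g) (φ : Dual K g) : (coord K u).1 φ = φ u := rfl

/-- The derivative along a constant vector field. -/
def dirDeriv (v : Dual K g) : Derivation K (AnalyticFun K g) (AnalyticFun K g) :=
  Derivation.mk'
    { toFun := fun f => ⟨fun φ => lineDeriv K f.1 φ v, f.2.lineDeriv v⟩
      map_add' := fun f h => Subtype.ext <| funext fun φ =>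
        (HasDerivAt.add (f.2.hasLineDerivAt φ v) (h.2.hasLineDerivAt φ v)).deriv.trans <| by
          rw [← f.2.lineDeriv_eq, ← h.2.lineDeriv_eq]; rfl
      map_smul' := fun c f => Subtype.ext <| funext fun φ =>
        (HasDerivAt.const_smul c (f.2.hasLineDerivAt φ v)).deriv.trans <| by
          rw [← f.2.lineDeriv_eq]; rfl }
    fun f h => Subtype.ext <| funext fun φ => by
      have := (HasDerivAt.mul (f.2.hasLineDerivAt φ v) (h.2.hasLineDerivAt φ v)).deriv
      refine this.trans ?_
      rw [zero_smul, add_zero, ← f.2.lineDeriv_eq, ← h.2.lineDeriv_eq]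
      change _ = f.1 φ * lineDeriv K h.1 φ v + h.1 φ * lineDeriv K f.1 φ v
      ring

theorem dirDeriv_apply (v : Dual K g) (f : AnalyticFun K g) (φ : Dual K g) :
    (dirDeriv v f).1 φ = lineDeriv K f.1 φ v := rfl

theorem dirDeriv_comm (v w : Dual K g) (f : AnalyticFun K g) :
    dirDeriv v (dirDeriv w f) = dirDeriv w (dirDeriv v f) :=
  Subtype.ext <| funext fun φ => f.2.lineDeriv_comm φ w v

theorem dirDeriv_coord (v : Dual K g) (u : g) :
    dirDeriv v (coord K u) = algebraMap K _ (v u) := by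
  ext φ
  rw [dirDeriv_apply, AnalyticFun.algebraMap_val]
  have : HasDerivAt (fun t : K => (φ + t • v) u) (v u) 0 := by
    simpa using ((hasDerivAt_id (0 : K)).mul_const (v u)).const_add (φ u)
  exact this.deriv

/-- The derivation given by a vector field, whose value on the linear function `u` is `V u`. -/
def vectorField (V : g →ₗ[K] AnalyticFun K g) : Derivation K (AnalyticFun K g) (AnalyticFun K g) :=
  ∑ j, V (finBasis K g j) • dirDeriv ((finBasis K g).coord j)

theorem vectorField_apply (V : g →ₗ[K] AnalyticFun K g) (f : AnalyticFun K g) :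
    vectorField V f = ∑ j, V (finBasis K g j) * dirDeriv ((finBasis K g).coord j) f := by
  rw [vectorField, ← Derivation.coeFnAddMonoidHom_apply, map_sum, Finset.sum_apply]
  rfl

theorem vectorField_coord (V : g →ₗ[K] AnalyticFun K g) (u : g) :
    vectorField V (coord K u) = V u := by
  rw [vectorField_apply]
  conv_rhs => rw [← (finBasis K g).sum_repr u]
  simp only [dirDeriv_coord, map_sum, map_smul, Basis.coord_apply, Algebra.smul_def]
  exact Finset.sum_congr rfl fun j _ => mul_comm _ _

theorem vectorField_add (V W : g →ₗ[K] AnalyticFun K g) (f : AnalyticFun K g) :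
    vectorField (V + W) f = vectorField V f + vectorField W f := by
  simp only [vectorField_apply, LinearMap.add_apply, add_mul, Finset.sum_add_distrib]

theorem vectorField_smul (c : K) (V : g →ₗ[K] AnalyticFun K g) (f : AnalyticFun K g) :
    vectorField (c • V) f = c • vectorField V f := by
  simp only [vectorField_apply, LinearMap.smul_apply, smul_mul_assoc, Finset.smul_sum]

/-- The second-order terms cancel because constant fields commute, so the commutator is the field
determined by its values on linear functions. -/
theorem vectorField_comm (V W : g →ₗ[K] AnalyticFun K g) (f : AnalyticFun K g) :
    vectorField V (vectorField W f) - vectorField W (vectorField V f) =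
      vectorField ((vectorField V).toLinearMap ∘ₗ W - (vectorField W).toLinearMap ∘ₗ V) f := by
  have h : ∀ V W : g →ₗ[K] AnalyticFun K g, vectorField V (vectorField W f) =
      ∑ j, vectorField V (W (finBasis K g j)) * dirDeriv ((finBasis K g).coord j) f +
      ∑ j, ∑ k, W (finBasis K g j) * (V (finBasis K g k) *
        dirDeriv ((finBasis K g).coord k) (dirDeriv ((finBasis K g).coord j) f)) := by
    intro V W
    rw [vectorField_apply W, map_sum, ← Finset.sum_add_distrib]
    refine Finset.sum_congr rfl fun j _ => ?_
    rw [Derivation.leibniz, vectorField_apply V (dirDeriv ((finBasis K g).coord j) f),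
      smul_eq_mul, smul_eq_mul,
      Finset.mul_sum]
    ring
  rw [h, h, vectorField_apply]
  simp only [LinearMap.sub_apply, LinearMap.comp_apply, Derivation.coeFn_coe, sub_mul,
    Finset.sum_sub_distrib]
  rw [Finset.sum_comm (f := fun j k => V (finBasis K g j) * _)]
  have : ∀ j k, V (finBasis K g k) * (W (finBasis K g j) *
        dirDeriv ((finBasis K g).coord j) (dirDeriv ((finBasis K g).coord k) f)) =
      W (finBasis K g j) * (V (finBasis K g k) *
        dirDeriv ((finBasis K g).coord k) (dirDeriv ((finBasis K g).coord j) f)) := by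
    intro j k
    rw [dirDeriv_comm]; ring
  simp only [this]
  abel

/-- The vector field at a point is the derivative along its value. -/
theorem vectorField_apply_apply (V : g →ₗ[K] AnalyticFun K g) (f : AnalyticFun K g)
    (φ v : Dual K g) (hv : ∀ u, v u = (V u).1 φ) :
    (vectorField V f).1 φ = lineDeriv K f.1 φ v := by
  have hv' : v = ∑ j, (V (finBasis K g j)).1 φ • (finBasis K g).coord j := by
    refine (finBasis K g).ext fun i => ?_
    simp [hv, Finsupp.single_apply]
  rw [vectorField_apply, f.2.lineDeriv_eq, hv', map_sum, map_sum]
  simp only [map_smul, ← f.2.lineDeriv_eq]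
  simp [dirDeriv_apply]

/-- The commutator of a vector field with a constant vector field. -/
theorem dirDeriv_vectorField (a : Dual K g) (V : g →ₗ[K] AnalyticFun K g) (f : AnalyticFun K g) :
    dirDeriv a (vectorField V f) =
      vectorField ((dirDeriv a).toLinearMap ∘ₗ V) f + vectorField V (dirDeriv a f) := by
  simp only [vectorField_apply, map_sum, ← Finset.sum_add_distrib]
  refine Finset.sum_congr rfl fun j _ => ?_
  rw [Derivation.leibniz, dirDeriv_comm]
  simp only [smul_eq_mul, LinearMap.comp_apply, Derivation.coeFn_coe]
  ring

end AnalyticFunctions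

end

end PoissonPencil

/-! ### Invariants inside the span of brackets -/

namespace LieAlgebra

open LieModule

/-- A finite-dimensional module over a semisimple Lie algebra contains no nonzero invariants in the
span of its brackets. -/
theorem IsSemisimple.eq_zero_of_mem_span_lie {K : Type*} [Field K] [CharZero K]
    {s : Type*} [LieRing s] [LieAlgebra K s] [FiniteDimensional K s] [IsSemisimple K s]
    {M : Type*} [AddCommGroup M] [Module K M] [LieRingModule s M] [LieModule K s M]
    [FiniteDimensional K M] {v : M} (hv : ∀ x : s, ⁅x, v⁆ = 0)
    (hspan : v ∈ Submodule.span K {m : M | ∃ (x : s) (n : M), ⁅x, n⁆ = m}) : v = 0 := by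
  by_contra hne
  -- `N` is the space of functionals vanishing at `v`, and `T v = 1`. Since `v` is invariant, `x ↦
  -- ⁅x, T⁆` is a cocycle in `N`, hence equals `⁅x, S⁆` with `S` in `N`. Then `T - S` kills all
  -- brackets but takes the value `1` at `v`.
  let N : LieSubmodule K s (Dual K M) :=
    { LinearMap.ker (Dual.eval K M v) with
      lie_mem := fun {x f} _ => by
        change (⁅x, f⁆ : Dual K M) v = 0
        rw [Module.Dual.lie_apply, hv, map_zero, neg_zero] }
  obtain ⟨T, hT⟩ := Projective.exists_dual_eq_one K hne
  let ω : s →ₗ[K] N := ((toEnd K s (Dual K M)).toLinearMap.flip T).codRestrict N.toSubmodule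
    fun x => by
      change (⁅x, T⁆ : Dual K M) v = 0
      rw [Module.Dual.lie_apply, hv, map_zero, neg_zero]
  have hω : ∀ x, (ω x : Dual K M) = ⁅x, T⁆ := fun x => rfl
  obtain ⟨⟨S, hS⟩, hSx⟩ := IsSemisimple.exists_lie_eq_of_oneCocycle (K := K) (s := s) N ω
    fun x y => Subtype.ext <| by
      push_cast
      rw [hω, hω, hω, lie_lie]
  have hSv : S v = 0 := hS
  have hinv : ∀ (x : s) (m : M), (T - S) ⁅x, m⁆ = 0 := fun x m => by
    have h1 : ⁅x, T⁆ = ⁅x, S⁆ := congrArg Subtype.val (hSx x)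
    have h2 := LinearMap.congr_fun h1 m
    rw [Module.Dual.lie_apply, Module.Dual.lie_apply, neg_inj] at h2
    rw [LinearMap.sub_apply, h2, sub_self]
  have : (T - S) v = 0 := by
    have hle : Submodule.span K {m : M | ∃ (x : s) (n : M), ⁅x, n⁆ = m} ≤ (T - S).ker := by
      rw [Submodule.span_le]
      rintro _ ⟨x, n, rfl⟩
      exact hinv x n
    exact hle hspan
  rw [LinearMap.sub_apply, hT, hSv, sub_zero] at this
  exact one_ne_zero this

end LieAlgebra

namespace PoissonPencil

noncomputable section

/-! ### Compatible brackets and the cocycle identity -/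

section Brackets

variable {K : Type*} [RCLike K] {g : Type*} [LieRing g] [LieAlgebra K g] [FiniteDimensional K g]

variable (K g) in
/-- The Lie--Poisson bracket of linear functions. -/
def lieBracket : g →ₗ[K] g →ₗ[K] AnalyticFun K g :=
  (LieModule.toEnd K g g).toLinearMap.compr₂ (coord K)

theorem lieBracket_apply (u v : g) : lieBracket K g u v = coord K ⁅u, v⁆ := rfl

theorem vectorField_lieBracket_comm (u v : g) (f : AnalyticFun K g) :
    vectorField (lieBracket K g u) (vectorField (lieBracket K g v) f)
      - vectorField (lieBracket K g v) (vectorField (lieBracket K g u) f)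
      = vectorField (lieBracket K g ⁅u, v⁆) f := by
  rw [vectorField_comm]
  congr 2
  ext e : 1
  simp only [LinearMap.sub_apply, LinearMap.comp_apply, Derivation.coeFn_coe, lieBracket_apply,
    vectorField_coord, ← map_sub, lie_lie]

/-- The hypothesis on `V` says that it is the Hamiltonian field of `h`: its value on `e` is `{h,
e}`. The conclusion expands `{h, f}` by the chain rule in `h`, which allows nonlinear `h`. -/
theorem vectorField_neg_apply {P : g →ₗ[K] g →ₗ[K] AnalyticFun K g} (hP : ∀ u v, P u v = - P v u)
    {h : AnalyticFun K g} {V : g →ₗ[K] AnalyticFun K g}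
    (hV : ∀ e, V e = - vectorField (P e) h) (f : AnalyticFun K g) :
    vectorField V f = ∑ j, dirDeriv ((finBasis K g).coord j) h *
      vectorField (P (finBasis K g j)) f := by
  simp only [vectorField_apply, hV, Finset.mul_sum, neg_mul, Finset.sum_mul,
    Finset.sum_neg_distrib]
  rw [Finset.sum_comm, ← Finset.sum_neg_distrib]
  refine Finset.sum_congr rfl fun j _ => ?_
  rw [← Finset.sum_neg_distrib]
  refine Finset.sum_congr rfl fun k _ => ?_
  rw [hP (finBasis K g k)]
  ring

/-- A bivector field on `g*`, given by the brackets of the linear functions, that is a Poisson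
bivector compatible with the Lie--Poisson one. -/
structure IsCompatible (P : g →ₗ[K] g →ₗ[K] AnalyticFun K g) : Prop where
  skew : ∀ u v, P u v = - P v u
  jacobi : ∀ u v w, vectorField (P w) (P u v) + vectorField (P u) (P v w)
    + vectorField (P v) (P w u) = 0
  compat : ∀ u v w, (vectorField (lieBracket K g w) (P u v) + P w ⁅u, v⁆)
    + (vectorField (lieBracket K g u) (P v w) + P u ⁅v, w⁆)
    + (vectorField (lieBracket K g v) (P w u) + P v ⁅w, u⁆) = 0

variable {P : g →ₗ[K] g →ₗ[K] AnalyticFun K g}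

/-- By Jacobi, the commutator of two Hamiltonian fields is the Hamiltonian field of the bracket. As
`P u v` is not linear, that field is written in coordinates. -/
theorem IsCompatible.vectorField_comm (hP : IsCompatible P) (u v : g) (f : AnalyticFun K g) :
    vectorField (P u) (vectorField (P v) f) - vectorField (P v) (vectorField (P u) f)
      = ∑ j, dirDeriv ((finBasis K g).coord j) (P u v) * vectorField (P (finBasis K g j)) f := by
  rw [PoissonPencil.vectorField_comm]
  refine vectorField_neg_apply hP.skew (fun e => ?_) f
  have := hP.jacobi u v e
  simp only [LinearMap.sub_apply, LinearMap.comp_apply, Derivation.coeFn_coe]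
  rw [hP.skew e u, map_neg] at this
  linear_combination this

/-- The same identity for the bracket `π₁ + t π₂`, coefficient of `t`. -/
theorem IsCompatible.vectorField_mixed_comm (hP : IsCompatible P) (u v : g) (f : AnalyticFun K g) :
    (vectorField (lieBracket K g u) (vectorField (P v) f)
      - vectorField (P v) (vectorField (lieBracket K g u) f))
    - (vectorField (lieBracket K g v) (vectorField (P u) f)
      - vectorField (P u) (vectorField (lieBracket K g v) f))
      = vectorField (P ⁅u, v⁆) f + ∑ j, dirDeriv ((finBasis K g).coord j) (P u v) *
          vectorField (lieBracket K g (finBasis K g j)) f := by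
  have hskew : ∀ u v : g, lieBracket K g u v = - lieBracket K g v u := fun u v => by
    rw [lieBracket_apply, lieBracket_apply, ← lie_skew, map_neg]
  rw [PoissonPencil.vectorField_comm, PoissonPencil.vectorField_comm]
  rw [← vectorField_neg_apply hskew (h := P u v)
    (V := ((vectorField (lieBracket K g u)).toLinearMap ∘ₗ P v
        - (vectorField (P v)).toLinearMap ∘ₗ lieBracket K g u)
      - ((vectorField (lieBracket K g v)).toLinearMap ∘ₗ P u
        - (vectorField (P u)).toLinearMap ∘ₗ lieBracket K g v) - P ⁅u, v⁆), ← vectorField_add]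
  · rw [eq_comm, ← sub_eq_zero]
    simp only [vectorField_apply, ← Finset.sum_sub_distrib]
    refine Finset.sum_eq_zero fun j _ => ?_
    simp only [LinearMap.add_apply, LinearMap.sub_apply]
    ring
  · intro e
    have := hP.compat u v e
    simp only [LinearMap.sub_apply, LinearMap.comp_apply, Derivation.coeFn_coe, lieBracket_apply,
      vectorField_coord] at this ⊢
    rw [hP.skew e u, map_neg, hP.skew e, ← lie_skew e u, map_neg] at this
    linear_combination this

/-- The cocycle property that makes it possible to extend a Magri--Lenard chain. -/
theorem IsCompatible.chain_cocycle (hP : IsCompatible P) {f f' : AnalyticFun K g}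
    (hf : ∀ u, vectorField (lieBracket K g u) f + vectorField (P u) f' = 0) (u v : g) :
    vectorField (lieBracket K g u) (vectorField (P v) f)
      - vectorField (lieBracket K g v) (vectorField (P u) f) = vectorField (P ⁅u, v⁆) f := by
  -- Replacing `{·, f}₁` by `-{·, f'}₂` turns the unwanted terms on the left of `h1` into the
  -- commutator of the fields `P u`, `P v` at `f'`; the sum on the right is the same commutator by
  -- `h2`.
  have h1 := hP.vectorField_mixed_comm u v f
  have h2 := hP.vectorField_comm u v f'
  have hf' : ∀ u, vectorField (lieBracket K g u) f = - vectorField (P u) f' := fun u =>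
    eq_neg_of_add_eq_zero_left (hf u)
  simp only [hf', map_neg, mul_neg, Finset.sum_neg_distrib, ← h2] at h1
  linear_combination h1

end Brackets

/-! ### Lie finite functions -/

section LieFinite

variable {K : Type*} [RCLike K] {s : Type*} [LieRing s] [LieAlgebra K s] [FiniteDimensional K s]

/-- The action of `s` on the analytic functions on `g*`, `g = s × K`, by Hamiltonian vector
fields. -/
instance : LieRingModule s (AnalyticFun K (s × K)) where
  bracket x f := vectorField (lieBracket K (s × K) (x, 0)) f
  add_lie x y f := by
    rw [← vectorField_add, ← map_add, Prod.mk_add_mk, add_zero]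
  lie_add x f h := map_add _ f h
  leibniz_lie x y f := by
    rw [← sub_eq_iff_eq_add, vectorField_lieBracket_comm]
    simp [LieAlgebra.Prod.bracket_apply]

theorem lie_def (x : s) (f : AnalyticFun K (s × K)) :
    ⁅x, f⁆ = vectorField (lieBracket K (s × K) (x, 0)) f := rfl

instance : LieModule K s (AnalyticFun K (s × K)) where
  smul_lie c x f := by
    rw [lie_def, lie_def, ← vectorField_smul, ← map_smul, Prod.smul_mk, smul_zero]
  lie_smul c x f := (vectorField _).map_smul c f

theorem lieBracket_eq (u : s × K) : lieBracket K (s × K) u = lieBracket K (s × K) (u.1, 0) := by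
  refine LinearMap.ext fun v => ?_
  simp [lieBracket_apply, LieAlgebra.Prod.bracket_apply, Ring.lie_def, mul_comm]

theorem vectorField_lieBracket (u : s × K) (f : AnalyticFun K (s × K)) :
    vectorField (lieBracket K (s × K) u) f = ⁅u.1, f⁆ := by
  rw [lieBracket_eq, lie_def]

theorem lie_mul (x : s) (f h : AnalyticFun K (s × K)) : ⁅x, f * h⁆ = f * ⁅x, h⁆ + h * ⁅x, f⁆ :=
  (vectorField _).leibniz f h

theorem lie_coord (x : s) (u : s × K) : ⁅x, coord K u⁆ = coord K ⁅(x, (0 : K)), u⁆ := by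
  rw [lie_def, vectorField_coord, lieBracket_apply]

/-- `f` lies in a finite-dimensional `s`-invariant space of functions. -/
def IsLieFinite (f : AnalyticFun K (s × K)) : Prop :=
  ∃ N : LieSubmodule K s (AnalyticFun K (s × K)), FiniteDimensional K N ∧ f ∈ N

theorem IsLieFinite.of_submodule {W : Submodule K (AnalyticFun K (s × K))}
    (hfin : FiniteDimensional K W) (hW : ∀ (x : s), ∀ f ∈ W, ⁅x, f⁆ ∈ W) {f : AnalyticFun K (s × K)}
    (hf : f ∈ W) : IsLieFinite f :=
  ⟨{ W with lie_mem := fun {x f} hf => hW x f hf }, hfin, hf⟩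

/-- The product of two invariant spaces of functions. -/
def mulLieSubmodule (N N' : LieSubmodule K s (AnalyticFun K (s × K))) :
    LieSubmodule K s (AnalyticFun K (s × K)) :=
  { N.toSubmodule * N'.toSubmodule with
    lie_mem := fun {x f} hf => by
      change ⁅x, f⁆ ∈ N.toSubmodule * N'.toSubmodule
      refine Submodule.mul_induction_on hf (fun m hm n hn => ?_) fun f h hf hh => ?_
      · rw [lie_mul]
        refine add_mem (Submodule.mul_mem_mul hm (N'.lie_mem hn)) ?_
        rw [mul_comm n]
        exact Submodule.mul_mem_mul (N.lie_mem hm) hn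
      · rw [lie_add]
        exact add_mem hf hh }

variable (K s) in
/-- The space of linear functions. -/
def linearLieSubmodule : LieSubmodule K s (AnalyticFun K (s × K)) :=
  { LinearMap.range (coord K (g := s × K)) with
    lie_mem := by
      rintro x _ ⟨u, rfl⟩
      exact ⟨_, (lie_coord x u).symm⟩ }

instance : FiniteDimensional K (linearLieSubmodule K s) :=
  inferInstanceAs (FiniteDimensional K (LinearMap.range (coord K (g := s × K))))

instance (N N' : LieSubmodule K s (AnalyticFun K (s × K))) [hN : FiniteDimensional K N]
    [hN' : FiniteDimensional K N'] : FiniteDimensional K (mulLieSubmodule N N') :=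
  Module.Finite.of_fg (((Module.Finite.iff_fg (N := N.toSubmodule)).mp hN).mul
    ((Module.Finite.iff_fg (N := N'.toSubmodule)).mp hN'))

variable (K s) in
/-- The algebra of Lie finite functions. -/
def lieFiniteAlgebra : Subalgebra K (AnalyticFun K (s × K)) where
  carrier := {f | IsLieFinite f}
  mul_mem' := by
    rintro f h ⟨N, hN, hf⟩ ⟨N', hN', hh⟩
    exact ⟨mulLieSubmodule N N', inferInstance, Submodule.mul_mem_mul hf hh⟩
  add_mem' := by
    rintro f h ⟨N, hN, hf⟩ ⟨N', hN', hh⟩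
    refine ⟨N ⊔ N', ?_, add_mem (le_sup_left (a := N) hf) (le_sup_right (a := N) hh)⟩
    change FiniteDimensional K (N ⊔ N').toSubmodule
    rw [LieSubmodule.sup_toSubmodule]
    exact Submodule.finite_sup N.toSubmodule N'.toSubmodule
  algebraMap_mem' := fun c => .of_submodule (W := Submodule.span K {algebraMap K _ c})
    inferInstance
    (fun x f hf => by
      obtain ⟨d, rfl⟩ := Submodule.mem_span_singleton.mp hf
      rw [lie_smul, lie_def, Derivation.map_algebraMap, smul_zero]
      exact zero_mem _)
    (Submodule.mem_span_singleton_self _)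

/-- An invariant function spans an invariant line. This admits arbitrary analytic Casimir functions
without expanding them into polynomials. -/
theorem mem_lieFiniteAlgebra_of_lie_eq_zero {f : AnalyticFun K (s × K)}
    (hf : ∀ x : s, ⁅x, f⁆ = 0) : f ∈ lieFiniteAlgebra K s :=
  .of_submodule (W := Submodule.span K {f}) inferInstance
    (fun x h hh => by
      obtain ⟨d, rfl⟩ := Submodule.mem_span_singleton.mp hh
      rw [lie_smul, hf, smul_zero]
      exact zero_mem _)
    (Submodule.mem_span_singleton_self _)

/-- The Hamiltonian field of `x` has linear coefficients, so its commutator with a constant field is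
constant. Hence the sum of the spaces of partial derivatives of `N` is invariant. -/
theorem dirDeriv_mem_lieFiniteAlgebra {f : AnalyticFun K (s × K)} (hf : f ∈ lieFiniteAlgebra K s)
    (j : Fin (finrank K (s × K))) :
    dirDeriv ((finBasis K (s × K)).coord j) f ∈ lieFiniteAlgebra K s := by
  obtain ⟨N, hN, hf⟩ := hf
  let D : Fin (finrank K (s × K)) → Submodule K (AnalyticFun K (s × K)) := fun j =>
    N.toSubmodule.map (dirDeriv ((finBasis K (s × K)).coord j)).toLinearMap
  have hD : ∀ j, ∀ h ∈ N, dirDeriv ((finBasis K (s × K)).coord j) h ∈ ⨆ j, D j := fun j h hh =>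
    Submodule.mem_iSup_of_mem j ⟨h, hh, rfl⟩
  have hfin : ∀ j, FiniteDimensional K (D j) := fun j =>
    Module.Finite.of_fg (((Module.Finite.iff_fg (N := N.toSubmodule)).mp hN).map _)
  refine .of_submodule (W := ⨆ j, D j) inferInstance (fun x h hh => ?_) (hD j f hf)
  refine Submodule.iSup_induction D (motive := fun h => ⁅x, h⁆ ∈ ⨆ j, D j) hh ?_ ?_ ?_
  · rintro j _ ⟨h, hh, rfl⟩
    have h1 := dirDeriv_vectorField ((finBasis K (s × K)).coord j)
      (lieBracket K (s × K) (x, 0)) h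
    rw [← lie_def, ← lie_def] at h1
    have h2 : ⁅x, (dirDeriv ((finBasis K (s × K)).coord j)).toLinearMap h⁆ = _ :=
      (sub_eq_iff_eq_add'.mpr h1).symm
    rw [h2]
    refine sub_mem (hD j _ (N.lie_mem hh)) ?_
    rw [vectorField_apply]
    refine sum_mem fun k _ => ?_
    simp only [LinearMap.comp_apply, Derivation.coeFn_coe, lieBracket_apply, dirDeriv_coord,
      ← Algebra.smul_def]
    exact Submodule.smul_mem _ _ (hD k h hh)
  · rw [lie_zero]; exact zero_mem _
  · intro f h hf hh
    rw [lie_add]; exact add_mem hf hh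

theorem vectorField_mem_lieFiniteAlgebra {V : (s × K) →ₗ[K] AnalyticFun K (s × K)}
    (hV : ∀ u, V u ∈ lieFiniteAlgebra K s) {f : AnalyticFun K (s × K)}
    (hf : f ∈ lieFiniteAlgebra K s) : vectorField V f ∈ lieFiniteAlgebra K s := by
  rw [vectorField_apply]
  exact sum_mem fun j _ => mul_mem (hV _) (dirDeriv_mem_lieFiniteAlgebra hf j)

/-- Finitely many Lie finite functions lie in a common finite-dimensional invariant space. -/
theorem exists_lieSubmodule_of_lieFinite {ι : Type*} [Finite ι] {f : ι → AnalyticFun K (s × K)}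
    (hf : ∀ i, f i ∈ lieFiniteAlgebra K s) :
    ∃ N : LieSubmodule K s (AnalyticFun K (s × K)), FiniteDimensional K N ∧ ∀ i, f i ∈ N := by
  choose N hN hfN using hf
  refine ⟨⨆ i, N i, ?_, fun i => le_iSup N i (hfN i)⟩
  change FiniteDimensional K (⨆ i, N i).toSubmodule
  rw [LieSubmodule.iSup_toSubmodule]
  have : ∀ i, FiniteDimensional K (N i).toSubmodule := hN
  exact Submodule.finite_iSup _

variable [LieAlgebra.IsSemisimple K s]

/-- Whitehead's first lemma for cocycles with values in Lie finite functions. -/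
theorem exists_lie_eq_of_lieFinite (T : s →ₗ[K] AnalyticFun K (s × K))
    (hT : ∀ x, T x ∈ lieFiniteAlgebra K s) (hcoc : ∀ x y, T ⁅x, y⁆ = ⁅x, T y⁆ - ⁅y, T x⁆) :
    ∃ f ∈ lieFiniteAlgebra K s, ∀ x, T x = ⁅x, f⁆ := by
  obtain ⟨N, hN, hTN⟩ := exists_lieSubmodule_of_lieFinite fun i => hT (finBasis K s i)
  have hTN' : ∀ x, T x ∈ N.toSubmodule := fun x => by
    rw [← (finBasis K s).sum_repr x, map_sum]
    exact sum_mem fun i _ => by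
      rw [map_smul]
      exact Submodule.smul_mem _ _ (hTN i)
  obtain ⟨⟨f, hf⟩, h⟩ := LieAlgebra.IsSemisimple.exists_lie_eq_of_oneCocycle (K := K) (s := s) N
    (T.codRestrict N.toSubmodule hTN') fun x y => Subtype.ext (hcoc x y)
  exact ⟨f, ⟨N, hN, hf⟩, fun x => congrArg Subtype.val (h x)⟩

theorem eq_zero_of_eq_sum_lie {ι : Type*} [Fintype ι] {f : AnalyticFun K (s × K)}
    (hf : ∀ x : s, ⁅x, f⁆ = 0) (x : ι → s) {h : ι → AnalyticFun K (s × K)}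
    (hh : ∀ i, h i ∈ lieFiniteAlgebra K s) (hsum : f = ∑ i, ⁅x i, h i⁆) : f = 0 := by
  obtain ⟨N, hN, hhN⟩ := exists_lieSubmodule_of_lieFinite hh
  have hfN : f ∈ N := by
    rw [hsum]
    exact sum_mem fun i _ => N.lie_mem (hhN i)
  have := LieAlgebra.IsSemisimple.eq_zero_of_mem_span_lie (K := K) (s := s) (v := (⟨f, hfN⟩ : N))
    (fun x => Subtype.ext (hf x)) (by
      have : (⟨f, hfN⟩ : N) = ∑ i, ⁅x i, (⟨h i, hhN i⟩ : N)⁆ := Subtype.ext (by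
        push_cast
        exact hsum)
      rw [this]
      exact sum_mem fun i _ => Submodule.subset_span ⟨_, _, rfl⟩)
  exact congrArg Subtype.val this

end LieFinite

/-! ### Quadratic polynomials as analytic functions -/

section Polynomials

variable {K : Type*} [RCLike K] {g : Type*} [AddCommGroup g] [Module K g]
  {h : Type*} [AddCommGroup h] [Module K h] [FiniteDimensional K h]

/-- A homogeneous quadratic polynomial pulled back along a linear map of the dual spaces, as an
analytic function. -/
theorem IsHomogeneousPoly.exists_analyticFun {f : Dual K g → K} (hf : IsHomogeneousPoly 2 f)
    (ι : g →ₗ[K] h) : ∃ F : AnalyticFun K h, (∀ φ, F.1 φ = f (φ ∘ₗ ι)) ∧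
      F ∈ LinearMap.range (coord K (g := h)) * LinearMap.range (coord K (g := h)) := by
  obtain ⟨p, hp, hpf⟩ := hf
  refine ⟨MvPolynomial.aeval (fun u => coord K (ι u)) p, fun φ => ?_, ?_⟩
  · rw [← AnalyticFun.evalHom_apply, MvPolynomial.comp_aeval_apply, hpf,
      ← MvPolynomial.coe_aeval_eq_eval]
    rfl
  · rw [← MvPolynomial.mem_homogeneousSubmodule, ← MvPolynomial.homogeneousSubmodule_one_pow,
      pow_two, MvPolynomial.homogeneousSubmodule_one_eq_span_X] at hp
    have := Submodule.mem_map_of_mem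
      (f := (MvPolynomial.aeval (R := K) (fun u => coord K (ι u))).toLinearMap) hp
    rw [Submodule.map_mul] at this
    have hle : (Submodule.span K (Set.range MvPolynomial.X)).map
        (MvPolynomial.aeval (R := K) (fun u => coord K (ι u))).toLinearMap
          ≤ LinearMap.range (coord K (g := h)) := by
      rw [Submodule.map_span, Submodule.span_le]
      rintro _ ⟨_, ⟨u, rfl⟩, rfl⟩
      exact ⟨ι u, by simp⟩
    exact mul_le_mul' hle hle this

/-- A product of linear functions pulled back along a linear map of the dual spaces is a homogeneous
quadratic polynomial. -/
theorem isHomogeneousPoly_of_mem_mul {F : AnalyticFun K h}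
    (hF : F ∈ LinearMap.range (coord K (g := h)) * LinearMap.range (coord K (g := h)))
    (ι : h →ₗ[K] g) : IsHomogeneousPoly 2 (fun ξ : Dual K g => F.1 (ξ ∘ₗ ι)) := by
  refine Submodule.mul_induction_on hF ?_ ?_
  · rintro _ ⟨u, rfl⟩ _ ⟨v, rfl⟩
    exact ⟨MvPolynomial.X (ι u) * MvPolynomial.X (ι v),
      (MvPolynomial.isHomogeneous_X K _).mul (MvPolynomial.isHomogeneous_X K _), fun φ => by simp⟩
  · rintro F G ⟨p, hp, hpF⟩ ⟨q, hq, hqG⟩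
    exact ⟨p + q, hp.add hq, fun φ => by simp [hpF, hqG]⟩

end Polynomials

/-! ### Passage from bivector fields to brackets of linear functions -/

section Bivectors

variable {K : Type*} [RCLike K] {g : Type*} [AddCommGroup g] [Module K g] [FiniteDimensional K g]

/-- The brackets of the linear functions with respect to a bivector with analytic coefficients. -/
def bivectorBracket (π : BivectorField K g) (h : ∀ u v, IsAnalytic (fun φ => π φ u v)) :
    g →ₗ[K] g →ₗ[K] AnalyticFun K g :=
  LinearMap.mk₂ K (fun u v => ⟨fun φ => π φ u v, h u v⟩)
    (fun u u' v => AnalyticFun.ext fun φ => by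
      change π φ (u + u') v = π φ u v + π φ u' v
      rw [map_add, LinearMap.add_apply])
    (fun c u v => AnalyticFun.ext fun φ => by
      change π φ (c • u) v = c * π φ u v
      rw [map_smul, LinearMap.smul_apply, smul_eq_mul])
    (fun u v v' => AnalyticFun.ext fun φ => map_add (π φ u) v v')
    (fun c u v => AnalyticFun.ext fun φ => map_smul (π φ u) c v)

variable {π : BivectorField K g}

theorem bivectorBracket_val (h : ∀ u v, IsAnalytic (fun φ => π φ u v)) (u v : g) (φ : Dual K g) :
    (bivectorBracket π h u v).1 φ = π φ u v := rfl

theorem ham_eq_vectorField {P : g →ₗ[K] g →ₗ[K] AnalyticFun K g}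
    (hP : ∀ u v φ, (P u v).1 φ = π φ u v) (f : AnalyticFun K g) (φ : Dual K g) (u : g) :
    ham π f.1 φ u = (vectorField (P u) f).1 φ :=
  (vectorField_apply_apply (P u) f φ (π φ u) fun v => (hP u v φ).symm).symm

end Bivectors

theorem lieBracket_val {K : Type*} [RCLike K] {g : Type*} [LieRing g] [LieAlgebra K g]
    [FiniteDimensional K g] (u v : g) (φ : Dual K g) :
    (lieBracket K g u v).1 φ = liePoisson K g φ u v := rfl

/-! ### Extension of Magri–Lenard chains -/

section ChainExtension

variable {K : Type*} [RCLike K] {s : Type*} [LieRing s] [LieAlgebra K s] [FiniteDimensional K s]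

/-- The contraction of the Lie--Poisson bivector with the second derivative of `f` vanishes. -/
theorem sum_lie_dirDeriv (f : AnalyticFun K (s × K)) :
    ∑ j, ⁅(finBasis K (s × K) j).1, dirDeriv ((finBasis K (s × K)).coord j) f⁆ = 0 := by
  set S := ∑ j, ⁅(finBasis K (s × K) j).1, dirDeriv ((finBasis K (s × K)).coord j) f⁆ with hS
  have h1 : S = ∑ j, ∑ k, lieBracket K (s × K) (finBasis K (s × K) j) (finBasis K (s × K) k) *
      dirDeriv ((finBasis K (s × K)).coord k) (dirDeriv ((finBasis K (s × K)).coord j) f) := by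
    rw [hS]
    refine Finset.sum_congr rfl fun j _ => ?_
    rw [← vectorField_lieBracket, vectorField_apply]
  -- Exchanging the indices preserves the second derivatives and changes the sign of the bracket.
  have h2 : S = - S := by
    conv_lhs => rw [h1]
    rw [Finset.sum_comm, h1, ← Finset.sum_neg_distrib]
    refine Finset.sum_congr rfl fun j _ => ?_
    rw [← Finset.sum_neg_distrib]
    refine Finset.sum_congr rfl fun k _ => ?_
    rw [dirDeriv_comm, lieBracket_apply, ← lie_skew, map_neg, lieBracket_apply, neg_mul]
  have h3 : (2 : K) • S = 0 := by
    rw [two_smul]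
    nth_rewrite 1 [h2]
    exact neg_add_cancel S
  exact (smul_eq_zero.mp h3).resolve_left two_ne_zero

variable [LieAlgebra.IsSemisimple K s] {P : s × K →ₗ[K] s × K →ₗ[K] AnalyticFun K (s × K)}

/-- A member of a Magri--Lenard chain is invariant under the Hamiltonian field of the central
element. -/
theorem IsCompatible.vectorField_central_eq_zero (hP : IsCompatible P)
    {q : AnalyticFun K (s × K)} (hq : q ∈ lieFiniteAlgebra K s)
    (hz : ∀ u : s × K, P (0, 1) u = ⁅u.1, q⁆)
    {f f' : AnalyticFun K (s × K)} (hf : f ∈ lieFiniteAlgebra K s)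
    (hchain : ∀ u, vectorField (lieBracket K (s × K) u) f + vectorField (P u) f' = 0) :
    vectorField (P (0, 1)) f = 0 := by
  have hskew : ∀ u v : s × K, lieBracket K (s × K) u v = - lieBracket K (s × K) v u := fun u v => by
    rw [lieBracket_apply, lieBracket_apply, ← lie_skew, map_neg]
  refine eq_zero_of_eq_sum_lie (fun x => ?_) (fun j => (finBasis K (s × K) j).1)
    (h := fun j => dirDeriv ((finBasis K (s × K)).coord j) (-q) * f)
    (fun j => mul_mem (dirDeriv_mem_lieFiniteAlgebra (neg_mem hq) j) hf) ?_
  -- Invariance: `(0, 1)` commutes with `(x, 0)` and acts by zero, so the cocycle identity has a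
  -- single term left.
  · have := hP.chain_cocycle hchain (x, 0) (0, 1)
    rw [vectorField_lieBracket, vectorField_lieBracket, zero_lie, sub_zero,
      LieAlgebra.Prod.bracket_apply, lie_zero, zero_lie] at this
    rw [this]
    change vectorField (P 0) f = 0
    rw [map_zero, vectorField_apply]
    exact Finset.sum_eq_zero fun j _ => zero_mul _
  -- The field `P (0, 1)` is the Lie–Poisson Hamiltonian field of `-q`. Pulling the coefficients
  -- `∂ⱼ(-q)` into the brackets costs only `f` times the sum in `sum_lie_dirDeriv`, which is zero.
  · rw [vectorField_neg_apply hskew (h := -q) fun e => by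
      rw [hz, vectorField_lieBracket, lie_neg, neg_neg]]
    simp only [vectorField_lieBracket, lie_mul, Finset.sum_add_distrib, ← Finset.mul_sum]
    rw [sum_lie_dirDeriv, mul_zero, add_zero]

/-- One step of a Magri--Lenard chain. -/
theorem IsCompatible.exists_chain_step (hP : IsCompatible P)
    (hfin : ∀ u v, P u v ∈ lieFiniteAlgebra K s) {q : AnalyticFun K (s × K)}
    (hq : q ∈ lieFiniteAlgebra K s) (hz : ∀ u : s × K, P (0, 1) u = ⁅u.1, q⁆)
    {f f' : AnalyticFun K (s × K)} (hf : f ∈ lieFiniteAlgebra K s)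
    (hchain : ∀ u, vectorField (lieBracket K (s × K) u) f + vectorField (P u) f' = 0) :
    ∃ h ∈ lieFiniteAlgebra K s,
      ∀ u, vectorField (lieBracket K (s × K) u) h + vectorField (P u) f = 0 := by
  let T : s →ₗ[K] AnalyticFun K (s × K) :=
    { toFun := fun x => - vectorField (P (x, 0)) f
      map_add' := fun x y => by
        rw [← neg_add, ← vectorField_add, ← map_add, Prod.mk_add_mk, add_zero]
      map_smul' := fun c x => by
        rw [RingHom.id_apply, smul_neg, ← vectorField_smul, ← map_smul, Prod.smul_mk, smul_zero] }
  have hT : ∀ x, T x = - vectorField (P (x, 0)) f := fun x => rfl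
  obtain ⟨h, hh, hTh⟩ := exists_lie_eq_of_lieFinite T
    (fun x => neg_mem (vectorField_mem_lieFiniteAlgebra (hfin _) hf)) fun x y => by
      have := hP.chain_cocycle hchain (x, 0) (y, 0)
      rw [vectorField_lieBracket, vectorField_lieBracket, LieAlgebra.Prod.bracket_apply,
        zero_lie] at this
      rw [hT, hT, hT, ← this, lie_neg, lie_neg]
      abel
  refine ⟨h, hh, fun u => ?_⟩
  -- On the `s` part the equation is the choice of `h`; on the central part both terms vanish.
  have hu : u = (u.1, 0) + u.2 • (0, 1) := by simp
  rw [vectorField_lieBracket, ← hTh, hT]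
  conv_lhs => rw [hu]
  simp only [map_add, map_smul, vectorField_add, vectorField_smul,
    hP.vectorField_central_eq_zero hq hz hf hchain, smul_zero, add_zero]
  simp

/-- Every Magri--Lenard chain can be continued. -/
theorem IsCompatible.exists_chain (hP : IsCompatible P)
    (hfin : ∀ u v, P u v ∈ lieFiniteAlgebra K s) {q : AnalyticFun K (s × K)}
    (hq : q ∈ lieFiniteAlgebra K s) (hz : ∀ u : s × K, P (0, 1) u = ⁅u.1, q⁆)
    {f f' : AnalyticFun K (s × K)} (hf : f ∈ lieFiniteAlgebra K s)
    (hchain : ∀ u, vectorField (lieBracket K (s × K) u) f + vectorField (P u) f' = 0) :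
    ∃ F : ℕ → AnalyticFun K (s × K), F 0 = f ∧
      ∀ i u, vectorField (lieBracket K (s × K) u) (F (i + 1)) + vectorField (P u) (F i) = 0 := by
  -- The recursion carries two consecutive members, since the cocycle identity for the last one uses
  -- its predecessor.
  let S := {p : AnalyticFun K (s × K) × AnalyticFun K (s × K) // p.2 ∈ lieFiniteAlgebra K s ∧
    ∀ u, vectorField (lieBracket K (s × K) u) p.2 + vectorField (P u) p.1 = 0}
  have step : ∀ p : S, ∃ p' : S, p'.1.1 = p.1.2 := fun p => by
    obtain ⟨h, hh, hc⟩ := hP.exists_chain_step hfin hq hz p.2.1 p.2.2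
    exact ⟨⟨(p.1.2, h), hh, hc⟩, rfl⟩
  choose next hnext using step
  let G : ℕ → S := fun i => next^[i] ⟨(f', f), hf, hchain⟩
  refine ⟨fun i => (G i).1.2, rfl, fun i u => ?_⟩
  have h1 : (G (i + 1)).1.1 = (G i).1.2 := by
    change (next^[i + 1] _).1.1 = _
    rw [Function.iterate_succ_apply', hnext]
  have h2 := (G (i + 1)).2.2 u
  rwa [h1] at h2

end ChainExtension

/-! ### Centrally linearizable bivectors: presentations and chains -/

section Presentation

variable {K : Type*} [RCLike K] {s : Type*} [LieRing s] [LieAlgebra K s]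
  {π₂ : BivectorField K (s × K)} {a : Dual K (s × K)}

theorem apply_of_res_eq_zero (ha : res a = 0) (x : s) : a (x, 0) = 0 :=
  LinearMap.congr_fun ha x

theorem apply_bracket_of_res_eq_zero (ha : res a = 0) (u v : s × K) : a ⁅u, v⁆ = 0 := by
  have : ⁅u, v⁆ = (⁅u.1, v.1⁆, (0 : K)) := by
    simp [LieAlgebra.Prod.bracket_apply, Ring.lie_def, mul_comm]
  rw [this, apply_of_res_eq_zero ha]

theorem IsCentrallyLinearizableAt.apply_ne_zero (h : IsCentrallyLinearizableAt π₂ a) :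
    a (0, 1) ≠ 0 := fun h0 => h.ne_zero <| LinearMap.ext fun u => by
  have hu : u = (u.1, 0) + u.2 • (0, 1) := by simp
  rw [hu, map_add, map_smul, h0, apply_of_res_eq_zero h.mem]
  simp

variable [FiniteDimensional K s]

theorem IsCentrallyLinearizableAt.exists_isCompatible (h : IsCentrallyLinearizableAt π₂ a) :
    ∃ P : s × K →ₗ[K] s × K →ₗ[K] AnalyticFun K (s × K),
      (∀ u v φ, (P u v).1 φ = π₂ φ u v) ∧ IsCompatible P ∧
      (∀ u v, P u v ∈ mulLieSubmodule (linearLieSubmodule K s) (linearLieSubmodule K s)) ∧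
      ∀ u v, dirDeriv a (P u v) = lieBracket K (s × K) u v := by
  have hquad : ∀ u v, ∃ F : AnalyticFun K (s × K), (∀ φ, F.1 φ = π₂ φ u v) ∧
      F ∈ mulLieSubmodule (linearLieSubmodule K s) (linearLieSubmodule K s) := fun u v =>
    (h.quadratic u v).exists_analyticFun LinearMap.id
  have hana : ∀ u v, IsAnalytic (fun φ => π₂ φ u v) := fun u v => by
    obtain ⟨F, hF, -⟩ := hquad u v
    have : (fun φ => π₂ φ u v) = F.1 := funext fun φ => (hF φ).symm
    rw [this]
    exact F.2
  set P := bivectorBracket π₂ hana with hPdef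
  have hP : ∀ u v φ, (P u v).1 φ = π₂ φ u v := bivectorBracket_val hana
  have hD : ∀ u v, dirDeriv a (P u v) = lieBracket K (s × K) u v := fun u v =>
    AnalyticFun.ext fun φ => h.linear φ u v
  have hD' : ∀ u, (dirDeriv a).toLinearMap ∘ₗ P u = lieBracket K (s × K) u := fun u =>
    LinearMap.ext fun v => hD u v
  have hj : ∀ u v w, vectorField (P w) (P u v) + vectorField (P u) (P v w)
      + vectorField (P v) (P w u) = 0 := fun u v w => AnalyticFun.ext fun φ => by
    have := h.poisson.jacobi φ u v w
    simp only [AnalyticFun.add_val, ← ham_eq_vectorField hP]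
    exact this
  refine ⟨P, hP, ⟨fun u v => AnalyticFun.ext fun φ => ?_, hj, fun u v w => ?_⟩, fun u v => ?_, hD⟩
  · rw [AnalyticFun.neg_val, hP, hP, (h.poisson.alt φ).neg]
  -- Jacobi is bilinear in `P`, and the derivative of `P` along `a` is the Lie–Poisson bracket, so
  -- the derivative of Jacobi is compatibility.
  · have := congrArg (dirDeriv a) (hj u v w)
    simpa only [map_add, map_zero, dirDeriv_vectorField, hD, hD', lieBracket_apply,
      vectorField_coord] using this
  · obtain ⟨F, hF, hFm⟩ := hquad u v
    have : P u v = F := AnalyticFun.ext fun φ => (hF φ).symm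
    rw [this]
    exact hFm

/-- A function with vanishing derivative along `a` is the pullback of its restriction to `s*`. -/
theorem val_eq_of_dirDeriv_eq_zero (ha : res a = 0) (ha' : a (0, 1) ≠ 0)
    {f : AnalyticFun K (s × K)} (hf : dirDeriv a f = 0) (φ : Dual K (s × K)) :
    f.1 φ = f.1 (ext (res φ)) := by
  have hd : ∀ (ψ : Dual K (s × K)) (t : K), HasDerivAt (fun r : K => f.1 (ψ + r • a)) 0 t := by
    intro ψ t
    have h0 : HasDerivAt (fun r : K => f.1 (ψ + t • a + r • a)) 0 (t - t) := by
      have h1 := f.2.hasLineDerivAt (ψ + t • a) a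
      rw [← f.2.lineDeriv_eq, ← dirDeriv_apply, hf, AnalyticFun.zero_val] at h1
      rw [sub_self]
      exact h1
    have h2 := h0.comp_sub_const t t
    have h3 : (fun r : K => f.1 (ψ + t • a + (r - t) • a)) = fun r : K => f.1 (ψ + r • a) := by
      funext r
      rw [add_assoc, ← add_smul, add_sub_cancel]
    rwa [h3] at h2
  have hc := is_const_of_deriv_eq_zero (fun t => (hd (ext (res φ)) t).differentiableAt)
    (fun t => (hd (ext (res φ)) t).deriv) (x₀ a φ) 0
  have hφ : φ = ext (res φ) + x₀ a φ • a := LinearMap.ext fun u => by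
    have hu : u = (u.1, 0) + u.2 • (0, 1) := by simp
    rw [hu]
    simp only [map_add, map_smul, LinearMap.add_apply, LinearMap.smul_apply,
      apply_of_res_eq_zero ha, x₀, smul_eq_mul, div_mul_cancel₀ _ ha']
    simp [ext, res, show φ (0, 0) = 0 from map_zero φ]
  rw [zero_smul, add_zero] at hc
  rw [← hc, ← hφ]

/-- The coordinate `x₀` as an analytic function. -/
def centralCoord (a : Dual K (s × K)) : AnalyticFun K (s × K) := (a (0, 1))⁻¹ • coord K (0, 1)

theorem centralCoord_val (a φ : Dual K (s × K)) : (centralCoord a).1 φ = x₀ a φ := by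
  rw [centralCoord, AnalyticFun.smul_val, coord_val, x₀, div_eq_inv_mul]

theorem lie_centralCoord (x : s) : ⁅x, centralCoord a⁆ = 0 := by
  rw [centralCoord, lie_smul, lie_coord, LieAlgebra.Prod.bracket_apply, lie_zero, zero_lie]
  change _ • coord K 0 = _
  rw [map_zero, smul_zero]

theorem dirDeriv_centralCoord (ha : a (0, 1) ≠ 0) : dirDeriv a (centralCoord a) = 1 := by
  rw [centralCoord, Derivation.map_smul, dirDeriv_coord, Algebra.smul_def, ← map_mul,
    inv_mul_cancel₀ ha, map_one]

/-- The Lie derivative of the Lie--Poisson bivector along the field `X + q ∂/∂x₀ - x₀ E`. -/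
theorem lieDerivative_tildeField (ha : res a = 0) {X : Dual K s → Dual K s} {q : Dual K s → K}
    {Θ : s → AnalyticFun K (s × K)} (hΘ : ∀ x φ, (Θ x).1 φ = X (res φ) x)
    {Q : AnalyticFun K (s × K)} (hQ : ∀ φ, Q.1 φ = q (res φ)) (φ : Dual K (s × K)) (u v : s × K) :
    lieDerivative (tildeField a X q) (liePoisson K (s × K)) φ u v =
      (Θ ⁅u.1, v.1⁆ + ⁅v.1, Θ u.1⁆ - ⁅u.1, Θ v.1⁆ + a u • ⁅v.1, Q⁆ - a v • ⁅u.1, Q⁆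
        + centralCoord a * lieBracket K (s × K) u v).1 φ := by
  let Z : s × K → AnalyticFun K (s × K) := fun w =>
    Θ w.1 + a w • Q - centralCoord a * coord K (w.1, 0)
  have hZ : ∀ w ψ, tildeField a X q ψ w = (Z w).1 ψ := fun w ψ => by
    simp only [Z, AnalyticFun.add_val, AnalyticFun.sub_val, AnalyticFun.smul_val,
      AnalyticFun.mul_val, centralCoord_val, coord_val, hΘ, hQ, tildeField, LinearMap.add_apply,
      LinearMap.sub_apply, LinearMap.smul_apply, smul_eq_mul]
    rw [mul_comm (a w)]
    rfl
  have hZ' : ∀ w, (fun ψ => tildeField a X q ψ w) = (Z w).1 := fun w => funext (hZ w)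
  have hlie : ∀ (x : s) w, ⁅x, Z w⁆ = ⁅x, Θ w.1⁆ + a w • ⁅x, Q⁆
      - centralCoord a * coord K (⁅x, w.1⁆, 0) := fun x w => by
    simp only [Z, lie_sub, lie_add, lie_smul, lie_mul, lie_centralCoord, lie_coord,
      LieAlgebra.Prod.bracket_apply, lie_zero, mul_zero, add_zero]
  have huv : ⁅u, v⁆ = (⁅u.1, v.1⁆, (0 : K)) := by
    simp [LieAlgebra.Prod.bracket_apply, Ring.lie_def, mul_comm]
  have h1 : lineDeriv K (fun ψ => liePoisson K (s × K) ψ u v) φ (tildeField a X q φ)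
      = (Z ⁅u, v⁆).1 φ := by
    have : lineDeriv K (coord K ⁅u, v⁆).1 φ (tildeField a X q φ) = tildeField a X q φ ⁅u, v⁆ := by
      rw [← dirDeriv_apply, dirDeriv_coord, AnalyticFun.algebraMap_val]
    rw [← hZ]
    exact this
  have hZuv : Z ⁅u, v⁆ = Θ ⁅u.1, v.1⁆ - centralCoord a * lieBracket K (s × K) u v := by
    simp only [Z, apply_bracket_of_res_eq_zero ha, zero_smul, add_zero, lieBracket_apply]
    rw [huv]
  have hvu : lieBracket K (s × K) u v = coord K (⁅u.1, v.1⁆, 0) := by rw [lieBracket_apply, huv]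
  have hvu' : coord K (⁅v.1, u.1⁆, (0 : K)) = - lieBracket K (s × K) u v := by
    rw [hvu, ← map_neg, ← lie_skew, Prod.neg_mk, neg_zero]
  -- The term `-x₀ E` contributes `-x₀ ⁅u, v⁆` through `Z ⁅u, v⁆` and `+x₀ ⁅u, v⁆` through each
  -- Hamiltonian term, so the net coefficient is `+1`.
  rw [lieDerivative, h1, hZ', hZ', ham_eq_vectorField lieBracket_val,
    ham_eq_vectorField lieBracket_val, vectorField_lieBracket, vectorField_lieBracket, hlie, hlie,
    hZuv, hvu', ← hvu, ← AnalyticFun.add_val, ← AnalyticFun.sub_val]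
  refine congrArg (fun f : AnalyticFun K (s × K) => f.1 φ) ?_
  ring

theorem mem_lieFiniteAlgebra_of_quadratic {f : AnalyticFun K (s × K)}
    (hf : f ∈ mulLieSubmodule (linearLieSubmodule K s) (linearLieSubmodule K s)) :
    f ∈ lieFiniteAlgebra K s :=
  ⟨mulLieSubmodule (linearLieSubmodule K s) (linearLieSubmodule K s), inferInstance, hf⟩

/-- The quadratic functions that do not depend on `x₀`. -/
def basicQuadrics (ha : res a = 0) : LieSubmodule K s (AnalyticFun K (s × K)) :=
  { (mulLieSubmodule (linearLieSubmodule K s) (linearLieSubmodule K s)).toSubmodule ⊓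
      LinearMap.ker (dirDeriv a).toLinearMap with
    lie_mem := fun {x f} hf => by
      refine ⟨LieSubmodule.lie_mem _ hf.1, ?_⟩
      have hf2 : dirDeriv a f = 0 := hf.2
      change dirDeriv a ⁅x, f⁆ = 0
      rw [lie_def, dirDeriv_vectorField, hf2, map_zero, add_zero, vectorField_apply]
      refine Finset.sum_eq_zero fun j _ => ?_
      rw [LinearMap.comp_apply, Derivation.coeFn_coe, lieBracket_apply, dirDeriv_coord,
        apply_bracket_of_res_eq_zero ha, map_zero, zero_mul] }

theorem mem_basicQuadrics (ha : res a = 0) {f : AnalyticFun K (s × K)} :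
    f ∈ basicQuadrics ha ↔ f ∈ mulLieSubmodule (linearLieSubmodule K s) (linearLieSubmodule K s) ∧
      dirDeriv a f = 0 := Iff.rfl

instance (ha : res a = 0) : FiniteDimensional K (basicQuadrics ha) :=
  have : FiniteDimensional K
      (mulLieSubmodule (linearLieSubmodule K s) (linearLieSubmodule K s)).toSubmodule :=
    inferInstanceAs (FiniteDimensional K
      (mulLieSubmodule (linearLieSubmodule K s) (linearLieSubmodule K s)))
  Submodule.finiteDimensional_of_le (S₁ := (basicQuadrics ha).toSubmodule) fun _ hf => hf.1

variable {P : s × K →ₗ[K] s × K →ₗ[K] AnalyticFun K (s × K)}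

/-- The quadratic polynomial of a presentation determines the brackets with the central element. -/
theorem IsPresentation.exists_quadric {X : Dual K s → Dual K s} {q : Dual K s → K}
    (h : IsCentrallyLinearizableAt π₂ a) (hXq : IsPresentation π₂ a X q)
    (hPπ : ∀ u v φ, (P u v).1 φ = π₂ φ u v) :
    ∃ Q ∈ lieFiniteAlgebra K s, (∀ φ, Q.1 φ = q (res φ)) ∧
      ∀ v, P (0, 1) v = a (0, 1) • ⁅v.1, Q⁆ := by
  obtain ⟨Q, hQ, hQm⟩ := hXq.polynomial.exists_analyticFun (LinearMap.inl K s K)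
  have hΘ := fun x => (hXq.vectorField x).exists_analyticFun (LinearMap.inl K s K)
  choose Θ hΘ _ using hΘ
  refine ⟨Q, mem_lieFiniteAlgebra_of_quadratic hQm, hQ, fun v => AnalyticFun.ext fun φ => ?_⟩
  have hΘ0 : Θ 0 = 0 := AnalyticFun.ext fun φ => by rw [hΘ, map_zero, AnalyticFun.zero_val]
  rw [hPπ, hXq.eq, lieDerivative_tildeField h.mem hΘ hQ, lieBracket_apply,
    LieAlgebra.Prod.bracket_apply]
  simp only [zero_lie, hΘ0, lie_zero, smul_zero, zero_add, add_zero, sub_zero, Ring.lie_def,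
    one_mul, mul_one, sub_self, Prod.mk_zero_zero, map_zero, mul_zero]

theorem isMagriLenardChain_of_vectorField (hPπ : ∀ u v φ, (P u v).1 φ = π₂ φ u v)
    {F : ℕ → AnalyticFun K (s × K)} (h0 : ∀ u, vectorField (lieBracket K (s × K) u) (F 0) = 0)
    (hs : ∀ i u, vectorField (lieBracket K (s × K) u) (F (i + 1)) + vectorField (P u) (F i) = 0) :
    IsMagriLenardChain (liePoisson K (s × K)) π₂ fun i => (F i).1 where
  analytic i := (F i).2
  zero φ u := by rw [ham_eq_vectorField lieBracket_val, h0, AnalyticFun.zero_val]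
  succ i φ u := by
    rw [ham_eq_vectorField lieBracket_val, ham_eq_vectorField hPπ, ← AnalyticFun.add_val, hs,
      AnalyticFun.zero_val]

/-- Every member of a Magri--Lenard chain belongs to the canonical involutive family. -/
theorem IsMagriLenardChain.mem_canonicalFamily {F : ℕ → Dual K (s × K) → K}
    (hF : IsMagriLenardChain (liePoisson K (s × K)) π₂ F) (i : ℕ) :
    F i ∈ canonicalFamily (liePoisson K (s × K)) π₂ :=
  ⟨1, fun _ => F i, fun y => y 0, fun _ => ⟨F, ⟨hF.analytic 0, hF.zero⟩, hF, i, rfl⟩,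
    (ContinuousLinearMap.proj (R := K) (φ := fun _ : Fin 1 => K) 0).analyticOnNhd _, fun _ => rfl⟩

variable [LieAlgebra.IsSemisimple K s]

/-- The brackets with the central element come from a quadratic function. -/
theorem IsCompatible.exists_central_eq (hP : IsCompatible P) (ha : res a = 0)
    (hquad : ∀ u v, P u v ∈ mulLieSubmodule (linearLieSubmodule K s) (linearLieSubmodule K s))
    (hD : ∀ u v, dirDeriv a (P u v) = lieBracket K (s × K) u v) :
    ∃ m ∈ basicQuadrics ha, ∀ x : s, P (x, 0) (0, 1) = ⁅x, m⁆ := by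
  let τ : s →ₗ[K] basicQuadrics ha :=
    (P.flip (0, 1) ∘ₗ LinearMap.inl K s K).codRestrict (basicQuadrics ha).toSubmodule fun x => by
      refine ⟨hquad _ _, ?_⟩
      change dirDeriv a (P (x, 0) (0, 1)) = 0
      rw [hD, lieBracket_apply, LieAlgebra.Prod.bracket_apply, lie_zero, zero_lie]
      exact map_zero _
  have hτ : ∀ x, (τ x : AnalyticFun K (s × K)) = P (x, 0) (0, 1) := fun x => rfl
  obtain ⟨⟨m, hm⟩, h⟩ := LieAlgebra.IsSemisimple.exists_lie_eq_of_oneCocycle (K := K) (s := s)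
    (basicQuadrics ha) τ fun x y => Subtype.ext <| by
      -- With a central third argument, compatibility is the 1-cocycle identity.
      have := hP.compat (x, 0) (y, 0) (0, 1)
      simp only [vectorField_lieBracket, LieAlgebra.Prod.bracket_apply, lie_zero, zero_lie,
        Prod.mk_zero_zero, map_zero, zero_add, add_zero] at this
      push_cast
      rw [hτ, hτ, hτ]
      rw [hP.skew (0, 1), hP.skew (0, 1) (x, 0), lie_neg] at this
      linear_combination -this
  exact ⟨m, hm, fun x => congrArg Subtype.val (h x)⟩

/-- The brackets of functions on `s*`, up to a multiple of the Lie--Poisson bracket, are a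
coboundary. -/
theorem IsCompatible.exists_coboundary_eq (hP : IsCompatible P) (ha : res a = 0)
    (ha' : a (0, 1) ≠ 0)
    (hquad : ∀ u v, P u v ∈ mulLieSubmodule (linearLieSubmodule K s) (linearLieSubmodule K s))
    (hD : ∀ u v, dirDeriv a (P u v) = lieBracket K (s × K) u v) :
    ∃ θ : s →ₗ[K] AnalyticFun K (s × K), (∀ x, θ x ∈ basicQuadrics ha) ∧
      ∀ x y : s, P (x, 0) (y, 0) - centralCoord a * lieBracket K (s × K) (x, 0) (y, 0) =
        ⁅x, θ y⁆ - ⁅y, θ x⁆ - θ ⁅x, y⁆ := by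
  have hmem : ∀ x y : s, P (x, 0) (y, 0) - centralCoord a * lieBracket K (s × K) (x, 0) (y, 0) ∈
      basicQuadrics ha := fun x y => by
    rw [mem_basicQuadrics]
    refine ⟨sub_mem (hquad _ _) (Submodule.mul_mem_mul ⟨(a (0, 1))⁻¹ • (0, 1), map_smul _ _ _⟩
      ⟨_, rfl⟩), ?_⟩
    rw [map_sub, hD, Derivation.leibniz, dirDeriv_centralCoord ha', lieBracket_apply,
      dirDeriv_coord, apply_bracket_of_res_eq_zero ha]
    simp
  let ω : s →ₗ[K] s →ₗ[K] basicQuadrics ha := LinearMap.mk₂ K (fun x y => ⟨_, hmem x y⟩)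
    (fun x x' y => Subtype.ext <| by
      push_cast
      rw [← Prod.mk_zero_add_mk_zero, map_add, map_add, LinearMap.add_apply, LinearMap.add_apply]
      ring)
    (fun c x y => Subtype.ext <| by
      push_cast
      rw [← smul_zero c, ← Prod.smul_mk, map_smul, map_smul, LinearMap.smul_apply,
        LinearMap.smul_apply, mul_smul_comm, smul_sub, smul_zero])
    (fun x y y' => Subtype.ext <| by
      push_cast
      rw [← Prod.mk_zero_add_mk_zero, map_add, map_add]
      ring)
    (fun c x y => Subtype.ext <| by
      push_cast
      rw [← smul_zero c, ← Prod.smul_mk, map_smul, map_smul, mul_smul_comm, smul_sub, smul_zero])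
  have hω : ∀ x y, (ω x y : AnalyticFun K (s × K)) =
    P (x, 0) (y, 0) - centralCoord a * coord K (⁅x, y⁆, 0) := fun x y => by
      change _ - _ = _
      rw [lieBracket_apply, LieAlgebra.Prod.bracket_apply, lie_zero]
  have hneg : ∀ x : s, coord K (-x, (0 : K)) = - coord K (x, 0) := fun x => by
    rw [← map_neg, Prod.neg_mk, neg_zero]
  obtain ⟨θ, hθ⟩ := LieAlgebra.IsSemisimple.exists_eq_of_twoCocycle (K := K) (s := s)
    (basicQuadrics ha) ω (fun x y => Subtype.ext <| by
      push_cast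
      rw [hω, hω, hP.skew, ← lie_skew, hneg]
      ring) fun x y z => Subtype.ext <| by
      have h1 := hP.compat (x, 0) (y, 0) (z, 0)
      have h2 : coord K (⁅x, ⁅y, z⁆⁆, (0 : K)) + coord K (⁅y, ⁅z, x⁆⁆, 0)
          + coord K (⁅z, ⁅x, y⁆⁆, 0) = 0 := by
        rw [← map_add, ← map_add, Prod.mk_add_mk, Prod.mk_add_mk, lie_jacobi, add_zero, add_zero]
        exact map_zero _
      simp only [vectorField_lieBracket, LieAlgebra.Prod.bracket_apply, lie_zero] at h1
      push_cast
      simp only [hω, lie_sub, lie_mul, lie_centralCoord, lie_coord, LieAlgebra.Prod.bracket_apply,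
        lie_zero, mul_zero, add_zero]
      rw [hP.skew (⁅x, y⁆, 0), hP.skew (⁅y, z⁆, 0), hP.skew (⁅z, x⁆, 0), ← lie_skew ⁅x, y⁆ z,
        ← lie_skew ⁅y, z⁆ x, ← lie_skew ⁅z, x⁆ y, hneg, hneg, hneg]
      -- The correction `x₀ ⁅·, ·⁆` produces the Jacobi sum twice: from the action on its values and
      -- from the brackets in its arguments.
      linear_combination h1 - 2 * centralCoord a * h2
  refine ⟨(basicQuadrics ha).toSubmodule.subtype ∘ₗ θ, fun x => (θ x).2, fun x y => ?_⟩
  exact congrArg Subtype.val (hθ x y)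

/-- Every centrally linearizable bivector has a presentation. -/
theorem IsCentrallyLinearizableAt.exists_isPresentation (h : IsCentrallyLinearizableAt π₂ a) :
    ∃ (X : Dual K s → Dual K s) (q : Dual K s → K), IsPresentation π₂ a X q := by
  have ha := h.mem
  have ha' := h.apply_ne_zero
  obtain ⟨P, hPπ, hP, hquad, hD⟩ := h.exists_isCompatible
  obtain ⟨m, hm, hmP⟩ := hP.exists_central_eq ha hquad hD
  obtain ⟨θ, hθ, hθP⟩ := hP.exists_coboundary_eq ha ha' hquad hD
  -- Signs and scale are forced by `lieDerivative_tildeField`: its coboundary in `Θ` is the negative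
  -- of the one in `θ`, and at `(x, 0), (0, 1)` it reads `-a (0, 1) • ⁅x, Q⁆`, which has to be `⁅x,
  -- m⁆`.
  let X : Dual K s → Dual K s := fun ξ =>
    (AnalyticFun.evalHom (ext ξ)).toLinearMap ∘ₗ (-θ)
  let Q : AnalyticFun K (s × K) := (-(a (0, 1))⁻¹) • m
  have hQm : Q ∈ basicQuadrics ha := (basicQuadrics ha).smul_mem _ hm
  have hθm : ∀ x, -θ x ∈ basicQuadrics ha := fun x => neg_mem (hθ x)
  have hΘ : ∀ x φ, (-θ x).1 φ = X (res φ) x := fun x φ =>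
    val_eq_of_dirDeriv_eq_zero ha ha' (hθm x).2 φ
  have hQ : ∀ φ, Q.1 φ = Q.1 (ext (res φ)) := val_eq_of_dirDeriv_eq_zero ha ha' hQm.2
  refine ⟨X, fun ξ => Q.1 (ext ξ), fun x => isHomogeneousPoly_of_mem_mul (hθm x).1
    (LinearMap.fst K s K), isHomogeneousPoly_of_mem_mul hQm.1 (LinearMap.fst K s K),
    fun φ u v => ?_⟩
  rw [lieDerivative_tildeField ha (Θ := fun x => -θ x) hΘ hQ, ← hPπ]
  refine congrArg (fun f : AnalyticFun K (s × K) => f.1 φ) ?_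
  have hdec : ∀ u : s × K, u = (u.1, 0) + u.2 • (0, 1) := fun u => by simp
  have hau : ∀ u : s × K, a u = u.2 * a (0, 1) := fun u => by
    conv_lhs => rw [hdec u]
    rw [map_add, map_smul, apply_of_res_eq_zero ha, zero_add, smul_eq_mul]
  have hzz : P (0, 1) (0, 1) = 0 := by
    have h2 : (2 : K) • P (0, 1) (0, 1) = 0 := by
      rw [two_smul]
      nth_rewrite 1 [hP.skew]
      exact neg_add_cancel _
    exact (smul_eq_zero.mp h2).resolve_left two_ne_zero
  have hPuv : P u v = P (u.1, 0) (v.1, 0) + v.2 • ⁅u.1, m⁆ - u.2 • ⁅v.1, m⁆ := by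
    conv_lhs => rw [hdec u, hdec v]
    simp only [map_add, map_smul, LinearMap.add_apply, LinearMap.smul_apply, hmP, hzz,
      hP.skew (0, 1) (v.1, 0), smul_zero, add_zero, smul_neg]
    abel
  have hL : lieBracket K (s × K) u v = lieBracket K (s × K) (u.1, 0) (v.1, 0) := by
    simp [lieBracket_apply, LieAlgebra.Prod.bracket_apply, Ring.lie_def, mul_comm]
  have hsm : ∀ w : s × K, ∀ x : s, a w • ⁅x, Q⁆ = - (w.2 • ⁅x, m⁆) := fun w x => by
    rw [lie_smul, smul_smul, hau, ← neg_smul]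
    congr 1
    field_simp
  rw [hsm, hsm, hPuv, hL, lie_neg, lie_neg]
  linear_combination hθP u.1 v.1

/-- Every Casimir function of the Lie--Poisson bivector starts a Magri--Lenard chain. -/
theorem IsCentrallyLinearizableAt.exists_chain_of_isCasimir (h : IsCentrallyLinearizableAt π₂ a)
    {f : Dual K (s × K) → K} (hf : IsCasimir (liePoisson K (s × K)) f) :
    ∃ F : ℕ → Dual K (s × K) → K, F 0 = f ∧ IsMagriLenardChain (liePoisson K (s × K)) π₂ F := by
  obtain ⟨P, hPπ, hP, hquad, -⟩ := h.exists_isCompatible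
  obtain ⟨X, q, hXq⟩ := h.exists_isPresentation
  obtain ⟨Q, hQ, -, hz⟩ := hXq.exists_quadric h hPπ
  let f₀ : AnalyticFun K (s × K) := ⟨f, hf.1⟩
  have hf₀ : ∀ u, vectorField (lieBracket K (s × K) u) f₀ = 0 := fun u =>
    AnalyticFun.ext fun φ => by
      rw [← ham_eq_vectorField lieBracket_val]
      exact hf.2 φ u
  -- A Casimir function continues the chain with fictitious predecessor `f' = 0`.
  obtain ⟨F, hF0, hF⟩ := hP.exists_chain (fun u v => mem_lieFiniteAlgebra_of_quadratic (hquad u v))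
    (q := a (0, 1) • Q) ((lieFiniteAlgebra K s).smul_mem hQ _) (fun u => by rw [hz, lie_smul])
    (f := f₀) (f' := 0) (mem_lieFiniteAlgebra_of_lie_eq_zero fun x => by rw [lie_def, hf₀])
    fun u => by rw [hf₀, map_zero, add_zero]
  exact ⟨fun i => (F i).1, congrArg Subtype.val hF0,
    isMagriLenardChain_of_vectorField hPπ (fun u => by rw [hF0, hf₀]) hF⟩

/-- For every presentation there is a Magri--Lenard chain starting with `x₀` and `q`. -/
theorem IsCentrallyLinearizableAt.exists_chain_of_isPresentation
    (h : IsCentrallyLinearizableAt π₂ a) {X : Dual K s → Dual K s} {q : Dual K s → K}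
    (hXq : IsPresentation π₂ a X q) :
    ∃ F : ℕ → Dual K (s × K) → K, F 0 = x₀ a ∧ F 1 = (fun φ => q (res φ)) ∧
      IsMagriLenardChain (liePoisson K (s × K)) π₂ F := by
  obtain ⟨P, hPπ, hP, hquad, -⟩ := h.exists_isCompatible
  obtain ⟨Q, hQ, hQq, hz⟩ := hXq.exists_quadric h hPπ
  have hstart : ∀ u, vectorField (lieBracket K (s × K) u) Q
      + vectorField (P u) (centralCoord a) = 0 := fun u => by
    rw [vectorField_lieBracket, centralCoord, Derivation.map_smul, vectorField_coord, hP.skew,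
      hz, smul_neg, smul_smul, inv_mul_cancel₀ h.apply_ne_zero, one_smul, add_neg_cancel]
  -- The recursion starts at `Q` with predecessor `x₀`, and `x₀` is prepended afterwards. Started at
  -- `x₀`, it would determine the second member only up to a Casimir function.
  obtain ⟨G, hG0, hG⟩ := hP.exists_chain (fun u v => mem_lieFiniteAlgebra_of_quadratic (hquad u v))
    (q := a (0, 1) • Q) ((lieFiniteAlgebra K s).smul_mem hQ _) (fun u => by rw [hz, lie_smul])
    hQ hstart
  let F : ℕ → AnalyticFun K (s × K) := fun i => i.casesOn (centralCoord a) G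
  refine ⟨fun i => (F i).1, funext (centralCoord_val a),
    (congrArg Subtype.val hG0).trans (funext hQq), isMagriLenardChain_of_vectorField hPπ
      (fun u => (vectorField_lieBracket u (centralCoord a)).trans (lie_centralCoord u.1))
      fun i u => ?_⟩
  cases i with
  | zero =>
    change vectorField _ (G 0) + vectorField _ (centralCoord a) = 0
    rw [hG0, hstart]
  | succ i => exact hG i u

end Presentation

end

end PoissonPencil

theorem mainTheorem6 {K : Type*} [RCLike K] {s : Type*} [LieRing s] [LieAlgebra K s]
    [FiniteDimensional K s] [LieAlgebra.IsSemisimple K s]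
    (π₂ : PoissonPencil.BivectorField K (s × K)) (a : Module.Dual K (s × K))
    (hπ₂ : PoissonPencil.IsCentrallyLinearizableAt π₂ a) :
    (∀ f : Module.Dual K (s × K) → K,
      PoissonPencil.IsCasimir (PoissonPencil.liePoisson K (s × K)) f →
      ∃ F : ℕ → Module.Dual K (s × K) → K, F 0 = f ∧
        PoissonPencil.IsMagriLenardChain (PoissonPencil.liePoisson K (s × K)) π₂ F) ∧
    (∃ (X : Module.Dual K s → Module.Dual K s) (q : Module.Dual K s → K),
      PoissonPencil.IsPresentation π₂ a X q) ∧
    (∀ (X : Module.Dual K s → Module.Dual K s) (q : Module.Dual K s → K),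
      PoissonPencil.IsPresentation π₂ a X q →
      (∃ F : ℕ → Module.Dual K (s × K) → K,
        F 0 = PoissonPencil.x₀ a ∧ F 1 = (fun φ => q (PoissonPencil.res φ)) ∧
        PoissonPencil.IsMagriLenardChain (PoissonPencil.liePoisson K (s × K)) π₂ F) ∧
      (fun φ => q (PoissonPencil.res φ)) ∈
        PoissonPencil.canonicalFamily (PoissonPencil.liePoisson K (s × K)) π₂) := by
  refine ⟨fun f hf => hπ₂.exists_chain_of_isCasimir hf, hπ₂.exists_isPresentation,
    fun X q hXq => ?_⟩
  obtain ⟨F, hF0, hF1, hF⟩ := hπ₂.exists_chain_of_isPresentation hXq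
  exact ⟨⟨F, hF0, hF1, hF⟩, hF1 ▸ hF.mem_canonicalFamily 1⟩
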